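/- Let $P$ be a finite $(\mathbf 3+\mathbf 1)$-free poset (no element of $P$ is incomparable to all three elements of a chain $a<b<c$ in $P$), put $n=|P|$, and let $r$ be a positive integer. Let $\mathrm{inc}(P)$ be the incomparability graph of $P$, let $X_{\mathrm{inc}(P)}(\mathbf x)=\sum_\kappa\prod_{p\in P}x_{\kappa(p)}$ be its chromatic symmetric function (the sum is over all proper colorings $\kappa\colon P\to\mathbb Z_{>0}$), and let $c^P_\lambda\in\mathbb Z$ ($\lambda\vdash n$) be its (uniquely determined) coefficients in the elementary symmetric functions, $X_{\mathrm{inc}(P)}(\mathbf x)=\sum_{\lambda\vdash n}c^P_\lambda e_\lambda(\mathbf x)$. A $P$-tableau of skew shape $\nu/\theta$ is a filling $T$ of its boxes by elements of $P$ with $T(i,j)<_P T(i+1,j)$ and $T(i,j)\not>_P T(i,j+1)$ whenever both boxes lie in the shape. A cylindric $P$-tableau of shape $\lambda/\mu/d$ is a function $T\colon\lambda/\mu\to P$ such that $T^d$ is a $P$-tableau, where $T^d$ is obtained from $T$ by gluing a copy of the first column of $T$, shifted up by $d$ cells, to the right of the last column of $T$. It is standard if it contains each element of $P$ exactly once. Then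 $$\sum_{\substack{\lambda\vdash n\\ \lambda_1\le r}}c^P_\lambda=\#\{\,T : T\text{ is a standard cylindric } P\text{-tableau of shape } (r^c t)/\varnothing/1\,\},$$ where $(r^c t)$ is the partition of $n$ with the maximal number $c=\lfloor n/r\rfloor$ of rows of length $r$ and, if $t=n-cr>0$, one further row of length $t$. -/

import Mathlib

/-! ### The chromatic symmetric function and the elementary symmetric functions

Symmetric functions in the infinitely many variables `x₁, x₂, …` are formal power series with
variables indexed by the positive integers `ℕ+`. -/

namespace CylindricTableaux

/-- The exponent vector of the monomial `x_κ = ∏ v, x_{κ v}`. -/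
noncomputable def colorWeight {V : Type*} [Fintype V] (κ : V → ℕ+) : ℕ+ →₀ ℕ :=
  ∑ v, Finsupp.single (κ v) 1

/-- The chromatic symmetric function `X_G = ∑ κ, x_κ` of a finite graph `G`, the sum being over all
proper colorings `κ : V → ℤ_{>0}`: the coefficient of the monomial `x ^ m` is the number of proper
colorings `κ` with `x_κ = x ^ m` (a finite number, since `V` is finite). -/
noncomputable def chromaticSymm {V : Type*} [Fintype V] (G : SimpleGraph V) :
    MvPowerSeries ℕ+ ℤ :=
  fun m => (Nat.card {κ : G.Coloring ℕ+ // colorWeight (fun v => κ v) = m} : ℤ)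

open Classical in
/-- The elementary symmetric function `e_k = ∑_{i₁ < ⋯ < i_k} x_{i₁} ⋯ x_{i_k}`: the sum of all
squarefree monomials of degree `k`. -/
noncomputable def elemSymm (k : ℕ) : MvPowerSeries ℕ+ ℤ :=
  fun m => if (∀ i, m i ≤ 1) ∧ m.degree = k then 1 else 0

/-- `e_ν = e_{ν₁} e_{ν₂} ⋯` for a partition `ν`. -/
noncomputable def elemSymmPart {n : ℕ} (ν : Nat.Partition n) : MvPowerSeries ℕ+ ℤ :=
  (ν.parts.map elemSymm).prod

/-- `c` is the family of coefficients of `X_G` in the elementary symmetric functions: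
`X_G = ∑_ν c_ν e_ν`. As `X_G` is homogeneous of degree `|V|`, the sum is over partitions of
`|V|`. -/
def IsElemExpansion {V : Type*} [Fintype V] (G : SimpleGraph V)
    (c : Nat.Partition (Fintype.card V) → ℤ) : Prop :=
  chromaticSymm G = ∑ ν, c ν • elemSymmPart ν

/-! ### Posets -/

/-- The incomparability graph `inc(P)`. -/
def incGraph (P : Type*) [PartialOrder P] : SimpleGraph P where
  Adj a b := IncompRel (· ≤ ·) a b
  symm := ⟨fun _ _ h => h.symm⟩
  loopless := ⟨fun _ h => h.1 le_rfl⟩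

/-- `P` is `(3+1)`-free: no element of `P` is incomparable to every element of a three-element
chain of `P`. -/
def IsThreePlusOneFree (P : Type*) [PartialOrder P] : Prop :=
  ¬ ∃ a b c d : P, a < b ∧ b < c ∧
    IncompRel (· ≤ ·) a d ∧ IncompRel (· ≤ ·) b d ∧ IncompRel (· ≤ ·) c d

/-! ### Cylindric `P`-tableaux

A filling of a set of boxes by elements of `P` is a function `A : ℕ × ℕ → Option P`, with value
`none` outside the set. The box `(i, j)` lies in row `i` and column `j`, English style; rows and
columns are numbered from `0`. -/

/-- The boxes of the skew shape `lam / mu`. -/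
def skewCells (lam mu : YoungDiagram) : Finset (ℕ × ℕ) := lam.cells \ mu.cells

/-- A function on a finite set of boxes, as a filling. -/
def toFilling {P : Type*} {S : Finset (ℕ × ℕ)} (T : S → P) : ℕ × ℕ → Option P :=
  fun b => if h : b ∈ S then some (T ⟨b, h⟩) else none

/-- The `P`-tableau condition: `A (i, j) <_P A (i + 1, j)` and `A (i, j) ≯_P A (i, j + 1)`, whenever
both boxes belong to the shape. -/
def IsPTableau {P : Type*} [PartialOrder P] (A : ℕ × ℕ → Option P) : Prop :=
  (∀ i j a b, A (i, j) = some a → A (i + 1, j) = some b → a < b) ∧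
  (∀ i j a b, A (i, j) = some a → A (i, j + 1) = some b → ¬ b < a)

/-- The diagram `A ^ d` for a filling `A` with columns `0, …, l - 1`: a copy of the first column of
`A` is glued to the right of the last column, shifted up by `d` boxes relative to `A`. Thus the
columns of `A` move down by `d`, and the copy, in column `l`, keeps the original rows. -/
def glue {P : Type*} (A : ℕ × ℕ → Option P) (l d : ℕ) : ℕ × ℕ → Option P :=
  fun b =>
    if b.2 < l then (if d ≤ b.1 then A (b.1 - d, b.2) else none)
    else if b.2 = l then A (b.1, 0) else none

/-- `T : lam / mu → P` is a cylindric `P`-tableau of shape `lam / mu / d`, i.e. `T ^ d` is a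
`P`-tableau. (As usual this is meant for `mu ⊆ lam` and for `d` large enough that the boxes of
`T ^ d` form a skew shape.) The number of columns of `lam` is `lam.rowLen 0`. -/
def IsCylindricPTableau {P : Type*} [PartialOrder P] (lam mu : YoungDiagram) (d : ℕ)
    (T : skewCells lam mu → P) : Prop :=
  IsPTableau (glue (toFilling T) (lam.rowLen 0) d)

/-- The set of standard cylindric `P`-tableaux of shape `lam / mu / d`: those which contain each
element of `P` exactly once. -/
def standardCylindric (P : Type*) [PartialOrder P] (lam mu : YoungDiagram) (d : ℕ) :
    Set (skewCells lam mu → P) :=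
  {T | IsCylindricPTableau lam mu d T ∧ ∀ p : P, ∃! b, T b = p}

theorem sortedGE_replicate_append (n r : ℕ) :
    (List.replicate (n / r) r ++ [n % r]).SortedGE := by
  rw [List.sortedGE_iff_pairwise, List.pairwise_append]
  refine ⟨List.pairwise_replicate.2 (Or.inr le_rfl), List.pairwise_singleton _ _, ?_⟩
  intro a ha b hb
  obtain ⟨h0, rfl⟩ := List.mem_replicate.1 ha
  rw [List.mem_singleton.1 hb]
  rcases Nat.eq_zero_or_pos a with rfl | h
  · simp at h0
  · exact (Nat.mod_lt n h).le

/-- The partition `(r^c t)` of `n` with the maximal number `c = ⌊n / r⌋` of rows of length `r`,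
followed by one row with the remaining `t = n - c r` boxes (an empty row if `t = 0`). -/
def rowsDiagram (n r : ℕ) : YoungDiagram :=
  YoungDiagram.ofRowLens (List.replicate (n / r) r ++ [n % r]) (sortedGE_replicate_append n r)

end CylindricTableaux

/-! Let `φ` be the linear functional with `φ(e_λ) = 1` if all parts of `λ` are at most `r`, and `0`
otherwise. It factors through setting all but `r` variables to zero, since `e_k` dies for `k > r`.
In degree `n` it is realised on monomials: `φ(x^α)` is `(-1)^n` times the sign of the `r + 1`
residues `j - α_j` (`j < r`) and `r + n` modulo `r + 1`, read as `0` when two of them coincide.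
Multiplying by `e_k` with `k ≤ r` preserves the value (`sum_cylWeight_add_indicator`).

Applied to the chromatic symmetric function, `φ` gives a signed count of proper `r`-colorings. A
coloring cuts `P` into `r` chains; chain `j` becomes column `j` of an array whose box in row `i` has
position `i r + j`. Positions wrap from the end of a row to the start of the next, which is exactly
the gluing with `d = 1`. So the arrays without flaws are the standard cylindric tableaux
(`isCylindricPTableau_iff`), and each has weight `1`.

Flawed arrays cancel by a Gasharov-type involution. At a flaw `q`, exchange the part of the column
of `q` from `q` downwards with the part of the column of `q + 1` strictly below `q + 1`. Freeness
from `3+1` keeps the columns chains (`IsArray.tailSwap`), and two residues are interchanged, so the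
sign flips (`IsArray.cylWeight_tailSwap`). The swap may create or destroy a flaw at `q - 1`, so it
does not preserve the first flaw. Instead it cancels the arrays with no flaw before `q - 1` and a
run of flaws starting at `q`; those that also have a flaw at `q - 1` have a longer run starting
earlier and vanish by induction. Runs of length `r` cannot occur, which ends the recursion
(`sum_hasFlaw_run`). -/

namespace CylindricTableaux

open Finset

/-! ### Signs of functions `Fin (r + 1) → ℤ/(r + 1)` -/

/-- The sign of a function `Fin (r + 1) → ℤ/(r + 1)`: the determinant of its 0-1-matrix. It is the
sign of `τ` as a permutation if `τ` is bijective, and zero otherwise. -/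
noncomputable def funSign {r : ℕ} (τ : Fin (r + 1) → ZMod (r + 1)) : ℤ :=
  Matrix.det (Matrix.of fun j i : Fin (r + 1) =>
    if τ j = ((i : ℕ) : ZMod (r + 1)) then (1 : ℤ) else 0)

theorem funSign_comp_swap {r : ℕ} (τ : Fin (r + 1) → ZMod (r + 1)) {a b : Fin (r + 1)}
    (hab : a ≠ b) : funSign (fun j => τ (Equiv.swap a b j)) = -funSign τ := by
  have h := Matrix.det_permute (Equiv.swap a b) (Matrix.of fun j i : Fin (r + 1) =>
    if τ j = ((i : ℕ) : ZMod (r + 1)) then (1 : ℤ) else 0)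
  rw [Equiv.Perm.sign_swap hab] at h
  rw [Units.val_neg, Units.val_one, Int.cast_neg, Int.cast_one, neg_one_mul] at h
  exact h

theorem funSign_eq_zero {r : ℕ} {τ : Fin (r + 1) → ZMod (r + 1)} {a b : Fin (r + 1)}
    (hab : a ≠ b) (h : τ a = τ b) : funSign τ = 0 := by
  have h1 := funSign_comp_swap τ hab
  have h2 : (fun j => τ (Equiv.swap a b j)) = τ := by
    funext j
    by_cases hja : j = a
    · subst hja; simp [h]
    · by_cases hjb : j = b
      · subst hjb; simp [h]
      · rw [Equiv.swap_apply_of_ne_of_ne hja hjb]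
  rw [h2] at h1
  linarith

theorem funSign_natCast (r : ℕ) :
    funSign (fun j : Fin (r + 1) => ((j : ℕ) : ZMod (r + 1))) = 1 := by
  have : (Matrix.of fun j i : Fin (r + 1) =>
      if ((j : ℕ) : ZMod (r + 1)) = ((i : ℕ) : ZMod (r + 1)) then (1 : ℤ) else 0) = 1 := by
    ext i j
    rw [Matrix.of_apply, Matrix.one_apply]
    congr 1
    rw [ZMod.natCast_eq_natCast_iff', Nat.mod_eq_of_lt i.2, Nat.mod_eq_of_lt j.2, Fin.ext_iff]
  rw [funSign, this, Matrix.det_one]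

/-- Lower the values of `τ` on `S` by one. -/
def lowerOn {r : ℕ} (τ : Fin (r + 1) → ZMod (r + 1)) (S : Finset (Fin (r + 1))) :
    Fin (r + 1) → ZMod (r + 1) :=
  fun j => if j ∈ S then τ j - 1 else τ j

/-- A nonempty proper subset of a cyclic group is not closed under subtracting one. So some value on
`S` has its predecessor taken outside `S`, and lowering makes the two collide. -/
theorem funSign_lowerOn_of_bijective {r : ℕ} {τ : Fin (r + 1) → ZMod (r + 1)}
    (hτ : Function.Bijective τ) {S : Finset (Fin (r + 1))} (h0 : S.Nonempty) (h1 : S ≠ univ) :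
    funSign (lowerOn τ S) = 0 := by
  by_cases H : ∃ j ∈ S, ∃ i ∉ S, τ i = τ j - 1
  · obtain ⟨j, hj, i, hi, hij⟩ := H
    refine funSign_eq_zero (a := i) (b := j) (fun h => hi (h ▸ hj)) ?_
    simp [lowerOn, hj, hi, hij]
  · exfalso
    push Not at H
    obtain ⟨j, hj⟩ := h0
    have key : ∀ (k : ℕ) (i), τ i = τ j - (k : ZMod (r + 1)) → i ∈ S := by
      intro k
      induction k with
      | zero =>
        intro i hi
        rw [Nat.cast_zero, sub_zero] at hi
        rwa [hτ.1 hi]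
      | succ k ih =>
        intro i hi
        obtain ⟨i', hi'⟩ := hτ.2 (τ j - (k : ZMod (r + 1)))
        by_contra hiS
        refine H i' (ih i' hi') i hiS ?_
        rw [hi, hi']; push_cast; ring
    apply h1
    rw [eq_univ_iff_forall]
    intro i
    refine key (ZMod.val (τ j - τ i)) i ?_
    rw [ZMod.natCast_zmod_val]; ring

/-- For bijective `τ` every term vanishes. If `τ a = τ b` with `a ≠ b`, transporting `S` along the
transposition of `a` and `b` negates its term, so the sum equals its own negative. -/
theorem sum_funSign_lowerOn {r k : ℕ} (hk : 0 < k) (hkr : k < r + 1)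
    (τ : Fin (r + 1) → ZMod (r + 1)) :
    ∑ S ∈ powersetCard k univ, funSign (lowerOn τ S) = 0 := by
  by_cases hτ : Function.Injective τ
  · have hb : Function.Bijective τ :=
      (Fintype.bijective_iff_injective_and_card τ).2 ⟨hτ, by simp [ZMod.card]⟩
    refine sum_eq_zero fun S hS => ?_
    rw [mem_powersetCard] at hS
    refine funSign_lowerOn_of_bijective hb (card_pos.1 (by omega)) ?_
    rintro rfl
    simp at hS
    omega
  · simp only [Function.Injective] at hτ
    push Not at hτ
    obtain ⟨a, b, hab, hne⟩ := hτ
    have h : ∑ S ∈ powersetCard k univ, funSign (lowerOn τ S) =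
        ∑ S ∈ powersetCard k univ, -funSign (lowerOn τ S) := by
      refine sum_nbij' (fun S => S.map (Equiv.swap a b).toEmbedding)
        (fun S => S.map (Equiv.swap a b).toEmbedding) ?_ ?_ ?_ ?_ ?_
      · intro S hS; simpa [mem_powersetCard] using hS
      · intro S hS; simpa [mem_powersetCard] using hS
      · intro S _; ext x; simp [mem_map_equiv]
      · intro S _; ext x; simp [mem_map_equiv]
      · intro S _
        rw [← funSign_comp_swap _ hne]
        congr 1
        funext j
        have : τ (Equiv.swap a b j) = τ j := by
          by_cases hja : j = a
          · subst hja; simp [hab]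
          · by_cases hjb : j = b
            · subst hjb; simp [hab]
            · rw [Equiv.swap_apply_of_ne_of_ne hja hjb]
        simp [lowerOn, this]
    rw [sum_neg_distrib] at h
    linarith

/-! ### The weight of an exponent vector -/

/-- The residues attached to the exponent vector `α` and the degree `n`. -/
def residues {r : ℕ} (n : ℕ) (α : Fin r → ℕ) : Fin (r + 1) → ZMod (r + 1) :=
  Fin.snoc (α := fun _ => ZMod (r + 1))
    (fun j : Fin r => ((j : ℕ) : ZMod (r + 1)) - (α j : ZMod (r + 1)))
    ((r : ZMod (r + 1)) + n)

@[simp] theorem residues_castSucc {r : ℕ} (n : ℕ) (α : Fin r → ℕ) (j : Fin r) :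
    residues n α j.castSucc = ((j : ℕ) : ZMod (r + 1)) - (α j : ZMod (r + 1)) := by
  simp [residues]

@[simp] theorem residues_last {r : ℕ} (n : ℕ) (α : Fin r → ℕ) :
    residues n α (Fin.last r) = (r : ZMod (r + 1)) + n := by
  simp [residues]

theorem residues_ext {r n : ℕ} {α : Fin r → ℕ} {τ : Fin (r + 1) → ZMod (r + 1)}
    (h : ∀ j : Fin r, τ j.castSucc = ((j : ℕ) : ZMod (r + 1)) - (α j : ZMod (r + 1)))
    (h' : τ (Fin.last r) = (r : ZMod (r + 1)) + n) : residues n α = τ := by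
  funext j
  induction j using Fin.lastCases with
  | last => rw [h', residues_last]
  | cast j => rw [h, residues_castSucc]

/-- The sign with which the colorings with color class sizes `α` are counted. -/
noncomputable def cylWeight {r : ℕ} (n : ℕ) (α : Fin r → ℕ) : ℤ := (-1) ^ n * funSign (residues n α)

theorem cylWeight_zero (r : ℕ) : cylWeight 0 (0 : Fin r → ℕ) = 1 := by
  rw [cylWeight, pow_zero, one_mul, ← funSign_natCast r]
  congr 1
  exact residues_ext (by simp) (by simp)

theorem sum_powersetCard_fin_succ {r : ℕ} (k : ℕ) (g : Finset (Fin (r + 1)) → ℤ) :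
    ∑ S ∈ powersetCard (k + 1) (univ : Finset (Fin (r + 1))), g S =
      ∑ S ∈ powersetCard (k + 1) (univ : Finset (Fin r)), g (S.map Fin.castSuccEmb) +
      ∑ S ∈ powersetCard k (univ : Finset (Fin r)),
        g (insert (Fin.last r) (S.map Fin.castSuccEmb)) := by
  have hl : Fin.last r ∉ (univ : Finset (Fin r)).map Fin.castSuccEmb := by
    simp [Fin.castSucc_ne_last]
  have hu : (univ : Finset (Fin (r + 1))) =
      insert (Fin.last r) ((univ : Finset (Fin r)).map Fin.castSuccEmb) := by
    ext j
    induction j using Fin.lastCases <;> simp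
  rw [hu, powersetCard_succ_insert hl, sum_union, powersetCard_map, sum_map, sum_image,
    powersetCard_map, sum_map]
  · rfl
  · intro S hS T hT h
    have hS' : Fin.last r ∉ S := fun h => hl ((mem_powersetCard.1 hS).1 h)
    have hT' : Fin.last r ∉ T := fun h => hl ((mem_powersetCard.1 hT).1 h)
    rw [← erase_insert hS', ← erase_insert hT', h]
  · rw [disjoint_left]
    intro S hS hS'
    obtain ⟨T, -, rfl⟩ := mem_image.1 hS'
    exact hl ((mem_powersetCard.1 hS).1 (mem_insert_self _ _))

/-- Apply `sum_funSign_lowerOn` to the residues in degree `n + k + 1`, splitting by whether the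
subset contains the last index. Lowering the last residue `r + n + k + 1` lands in degree `n + k`,
so the sums for `k + 1` and for `k` are opposite, and the factor `(-1)^n` makes them equal. -/
theorem sum_cylWeight_add_indicator {r : ℕ} (n : ℕ) (α : Fin r → ℕ) {k : ℕ} (hk : k ≤ r) :
    ∑ S ∈ powersetCard k (univ : Finset (Fin r)),
      cylWeight (n + k) (fun j => α j + if j ∈ S then 1 else 0) = cylWeight n α := by
  induction k with
  | zero => simp
  | succ k ih =>
    rw [← ih (by omega)]
    have h := sum_funSign_lowerOn (r := r) (k := k + 1) (by omega) (by omega)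
      (residues (n + k + 1) α)
    rw [sum_powersetCard_fin_succ] at h
    have h1 : ∀ S : Finset (Fin r), lowerOn (residues (n + k + 1) α) (S.map Fin.castSuccEmb) =
        residues (n + (k + 1)) (fun j => α j + if j ∈ S then 1 else 0) := by
      intro S
      refine (residues_ext ?_ ?_).symm
      · intro j
        by_cases hj : j ∈ S <;> simp [lowerOn, hj]
        ring
      · simp [lowerOn, Fin.castSucc_ne_last, add_assoc]
    have h2 : ∀ S : Finset (Fin r),
        lowerOn (residues (n + k + 1) α) (insert (Fin.last r) (S.map Fin.castSuccEmb)) =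
        residues (n + k) (fun j => α j + if j ∈ S then 1 else 0) := by
      intro S
      refine (residues_ext ?_ ?_).symm
      · intro j
        by_cases hj : j ∈ S <;> simp [lowerOn, hj, Fin.castSucc_ne_last]
        ring
      · simp [lowerOn]
        ring
    simp only [h1, h2] at h
    simp only [cylWeight, ← mul_sum]
    rw [eq_neg_of_add_eq_zero_left h, ← add_assoc, pow_succ]
    ring

/-! ### The functional `e_k ↦ 1` for `k ≤ r`, `e_k ↦ 0` for `k > r` -/

/-- The linear functional on polynomials in `r` variables which maps the monomial with exponent `α`
to `cylWeight n α`. -/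
noncomputable def cylFunctional (r n : ℕ) : MvPolynomial (Fin r) ℤ →ₗ[ℤ] ℤ :=
  (MvPolynomial.basisMonomials (Fin r) ℤ).constr ℤ fun α => cylWeight n α

theorem cylFunctional_monomial (r n : ℕ) (α : Fin r →₀ ℕ) :
    cylFunctional r n (MvPolynomial.monomial α 1) = cylWeight n α := by
  have h := (MvPolynomial.basisMonomials (Fin r) ℤ).constr_basis ℤ
    (fun α : Fin r →₀ ℕ => cylWeight n α) α
  rwa [MvPolynomial.coe_basisMonomials] at h

theorem cylFunctional_mul_esymm (r n k : ℕ) (f : MvPolynomial (Fin r) ℤ) :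
    cylFunctional r (n + k) (f * MvPolynomial.esymm (Fin r) ℤ k) =
      if k ≤ r then cylFunctional r n f else 0 := by
  split_ifs with hk
  · induction f using MvPolynomial.induction_on' with
    | monomial u a =>
      have hu : MvPolynomial.monomial u a = a • MvPolynomial.monomial u (1 : ℤ) := by
        simp [MvPolynomial.smul_monomial]
      rw [hu, smul_mul_assoc, map_smul, map_smul, cylFunctional_monomial,
        MvPolynomial.esymm_eq_sum_monomial, mul_sum, map_sum,
        ← sum_cylWeight_add_indicator n u hk]
      congr 1
      refine sum_congr rfl fun S _ => ?_
      rw [MvPolynomial.monomial_mul, one_mul, cylFunctional_monomial]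
      congr 1
      funext j
      simp [Finsupp.single_apply]
    | add p q hp hq => rw [add_mul, map_add, map_add, hp, hq]
  · rw [MvPolynomial.esymm, powersetCard_eq_empty.2 (by simpa using hk)]
    simp

theorem cylFunctional_prod_esymm (r : ℕ) (s : Multiset ℕ) :
    cylFunctional r s.sum (s.map (MvPolynomial.esymm (Fin r) ℤ)).prod =
      if ∀ k ∈ s, k ≤ r then 1 else 0 := by
  induction s using Multiset.induction_on with
  | empty =>
    have := cylFunctional_monomial r 0 0
    simpa [cylWeight_zero] using this
  | cons k s ih =>
    rw [Multiset.map_cons, Multiset.prod_cons, Multiset.sum_cons, mul_comm, add_comm,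
      cylFunctional_mul_esymm, ih]
    by_cases h : k ≤ r <;> simp [h]

end CylindricTableaux

/-! ### Passage from power series to polynomials, and the expansion in elementary symmetric
functions. -/

namespace CylindricTableaux

open Finset MvPolynomial

/-! ### Restriction to finitely many variables -/

theorem degree_embDomain {σ τ : Type*} (e : σ ↪ τ) (α : σ →₀ ℕ) :
    (Finsupp.embDomain e α).degree = α.degree := by
  simp [Finsupp.degree_apply, Finsupp.support_embDomain]

open Classical in
theorem coeff_esymm_eq_ite (m k : ℕ) (α : Fin m →₀ ℕ) :
    coeff α (esymm (Fin m) ℤ k) = if (∀ i, α i ≤ 1) ∧ α.degree = k then 1 else 0 := by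
  have hval : ∀ (S : Finset (Fin m)) (i : Fin m),
      (∑ j ∈ S, Finsupp.single j 1 : Fin m →₀ ℕ) i = if i ∈ S then 1 else 0 := by
    intro S i
    simp [Finsupp.single_apply]
  rw [esymm_eq_sum_monomial, coeff_sum]
  simp only [coeff_monomial]
  split_ifs with h
  · have hS : (∑ j ∈ α.support, Finsupp.single j 1 : Fin m →₀ ℕ) = α := by
      ext i
      rw [hval]
      have := h.1 i
      split_ifs with hi <;> simp at hi <;> omega
    have hc : #α.support = k := by
      rw [← h.2, ← hS, map_sum]
      simp [hS]
    rw [sum_eq_single α.support]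
    · rw [if_pos hS]
    · intro S _ hne
      rw [if_neg]
      rintro rfl
      apply hne
      ext i
      rw [Finsupp.mem_support_iff, hval]
      simp
    · intro h'
      exact absurd (mem_powersetCard.2 ⟨subset_univ _, hc⟩) h'
  · refine sum_eq_zero fun S hS => if_neg ?_
    rintro rfl
    refine h ⟨fun i => ?_, ?_⟩
    · rw [hval]; split_ifs <;> omega
    · rw [map_sum]
      simpa using (mem_powersetCard.1 hS).2

theorem killCompl_elemSymm {m : ℕ} (e : Fin m ↪ ℕ+) (k : ℕ) :
    MvPowerSeries.killCompl e (elemSymm k) =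
      MvPolynomial.coeToMvPowerSeries.ringHom (esymm (Fin m) ℤ k) := by
  classical
  ext α
  rw [MvPowerSeries.coeff_killCompl, coeToMvPowerSeries.ringHom_apply, coeff_coe,
    coeff_esymm_eq_ite]
  change (if _ then _ else _) = _
  congr 1
  rw [degree_embDomain]
  congr 1
  refine propext ⟨fun h i => ?_, fun h i => ?_⟩
  · simpa using h (e i)
  · by_cases hi : i ∈ Set.range e
    · obtain ⟨j, rfl⟩ := hi
      simpa using h j
    · rw [Finsupp.embDomain_of_notMem_range _ _ _ hi]
      omega

theorem killCompl_elemSymmPart {m n : ℕ} (e : Fin m ↪ ℕ+) (ν : n.Partition) :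
    MvPowerSeries.killCompl e (elemSymmPart ν) =
      MvPolynomial.coeToMvPowerSeries.ringHom (esymmPart (Fin m) ℤ ν) := by
  rw [elemSymmPart, esymmPart, map_multiset_prod, map_multiset_prod, Multiset.map_map,
    Multiset.map_map]
  congr 1
  exact Multiset.map_congr rfl fun k _ => killCompl_elemSymm e k

open Classical in
/-- The chromatic symmetric polynomial in `m` variables. -/
noncomputable def chromaticPoly {V : Type*} [Fintype V] (G : SimpleGraph V) (m : ℕ) :
    MvPolynomial (Fin m) ℤ :=
  ∑ κ : V → Fin m with ∀ a b, G.Adj a b → κ a ≠ κ b, monomial (∑ v, Finsupp.single (κ v) 1) 1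

theorem killCompl_chromaticSymm {V : Type*} [Fintype V] (G : SimpleGraph V) {m : ℕ}
    (e : Fin m ↪ ℕ+) :
    MvPowerSeries.killCompl e (chromaticSymm G) =
      MvPolynomial.coeToMvPowerSeries.ringHom (chromaticPoly G m) := by
  classical
  have hw : ∀ κ : V → Fin m, Finsupp.embDomain e (∑ v, Finsupp.single (κ v) 1) =
      colorWeight (fun v => e (κ v)) := by
    intro κ
    rw [colorWeight, Finsupp.embDomain_eq_mapDomain, ← Finsupp.mapDomain.addMonoidHom_apply,
      map_sum]
    simp
  ext α
  rw [MvPowerSeries.coeff_killCompl, coeToMvPowerSeries.ringHom_apply, coeff_coe, chromaticPoly,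
    coeff_sum]
  simp only [coeff_monomial]
  rw [← sum_filter, sum_const, nsmul_one, filter_filter, ← Fintype.card_subtype,
    ← Nat.card_eq_fintype_card]
  change ((Nat.card _ : ℕ) : ℤ) = _
  congr 1
  symm
  refine Nat.card_eq_of_bijective (fun κ => ⟨⟨fun v => e (κ.1 v), ?_⟩, ?_⟩) ⟨?_, ?_⟩
  · intro a b hab h
    exact κ.2.1 a b hab (e.injective h)
  · have := hw κ.1
    rw [κ.2.2] at this
    exact this.symm
  · intro κ κ' h
    ext v
    have : e (κ.1 v) = e (κ'.1 v) := congrArg (fun x => x.1 v) h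
    exact congrArg Fin.val (e.injective this)
  · rintro ⟨κ, hκ⟩
    have hr : ∀ v, ∃ j, e j = κ v := by
      intro v
      by_contra hv
      have h1 : Finsupp.embDomain e α (κ v) = 0 :=
        Finsupp.embDomain_of_notMem_range _ _ _ (by simpa using hv)
      rw [← hκ, colorWeight, Finsupp.finsetSum_apply, sum_eq_zero_iff] at h1
      simpa using h1 v (mem_univ v)
    choose κ' hκ' using hr
    refine ⟨⟨κ', ?_, ?_⟩, ?_⟩
    · intro a b hab h
      refine κ.valid hab ?_
      rw [← hκ', ← hκ', h]
    · apply Finsupp.embDomain_injective e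
      rw [hw, ← hκ]
      congr 1
      funext v
      exact hκ' v
    · refine Subtype.ext (DFunLike.ext _ _ fun v => ?_)
      exact hκ' v

theorem isHomogeneous_prod_esymm (m : ℕ) (s : Multiset ℕ) :
    ((s.map (esymm (Fin m) ℤ)).prod).IsHomogeneous s.sum := by
  induction s using Multiset.induction_on with
  | empty => simpa using isHomogeneous_one (Fin m) ℤ
  | cons k s ih =>
    rw [Multiset.map_cons, Multiset.prod_cons, Multiset.sum_cons]
    refine IsHomogeneous.mul ?_ ih
    rw [esymm_eq_sum_monomial]
    refine IsHomogeneous.sum _ _ _ fun S hS => isHomogeneous_monomial _ ?_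
    rw [map_sum]
    simpa using (mem_powersetCard.1 hS).2

theorem isHomogeneous_chromaticPoly {V : Type*} [Fintype V] (G : SimpleGraph V) (m : ℕ) :
    (chromaticPoly G m).IsHomogeneous (Fintype.card V) := by
  refine IsHomogeneous.sum _ _ _ fun κ _ => isHomogeneous_monomial _ ?_
  rw [map_sum]
  simp

theorem isSymmetric_chromaticPoly {V : Type*} [Fintype V] (G : SimpleGraph V) (m : ℕ) :
    (chromaticPoly G m).IsSymmetric := by
  classical
  intro π
  rw [chromaticPoly, map_sum]
  refine sum_nbij' (fun κ v => π (κ v)) (fun κ v => π.symm (κ v)) ?_ ?_ ?_ ?_ ?_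
  · intro κ hκ
    simpa using hκ
  · intro κ hκ
    simpa using hκ
  · intro κ _; simp
  · intro κ _; simp
  · intro κ _
    rw [rename_monomial, ← Finsupp.mapDomain.addMonoidHom_apply, map_sum]
    simp

/-! ### The expansion in elementary symmetric functions -/

/-- The multiset containing `i + 1` with multiplicity `t i`. -/
def partsOf {n : ℕ} (t : Fin n →₀ ℕ) : Multiset ℕ := ∑ i, t i • {(i : ℕ) + 1}

theorem esymmAlgHomMonomial_eq {m n : ℕ} (t : Fin n →₀ ℕ) (a : ℤ) :
    esymmAlgHomMonomial (Fin m) t a = C a * ((partsOf t).map (esymm (Fin m) ℤ)).prod := by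
  rw [esymmAlgHomMonomial, esymmAlgHom_apply, aeval_monomial, partsOf,
    ← Multiset.coe_mapAddMonoidHom, map_sum, Multiset.prod_sum, Finsupp.prod_fintype _ _ (by simp)]
  simp only [map_nsmul, Multiset.prod_nsmul]
  simp [algebraMap_eq]

/-- By the fundamental theorem `p` is a polynomial in `e_1, …, e_n`; taking the component of degree
`n` leaves only products indexed by partitions of `n`. -/
theorem mem_span_esymmPart {n : ℕ} {p : MvPolynomial (Fin n) ℤ} (hs : p.IsSymmetric)
    (hh : p.IsHomogeneous n) :
    p ∈ Submodule.span ℤ (Set.range fun ν : n.Partition => esymmPart (Fin n) ℤ ν) := by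
  obtain ⟨q, hq⟩ := esymmAlgHom_fin_surjective ℤ (le_refl n) ⟨p, hs⟩
  have hp : p = ∑ t ∈ q.support, esymmAlgHomMonomial (Fin n) t (q.coeff t) := by
    have h : ((esymmAlgHom (Fin n) ℤ n q : _) : MvPolynomial (Fin n) ℤ) = p := by rw [hq]
    conv_lhs => rw [← h, q.as_sum, map_sum, AddSubmonoidClass.coe_finsetSum]
    rfl
  have hc := homogeneousComponent_eq_self hh
  rw [← hc, hp, map_sum]
  refine Submodule.sum_mem _ fun t _ => ?_
  rw [esymmAlgHomMonomial_eq, homogeneousComponent_C_mul,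
    homogeneousComponent_of_mem (isHomogeneous_prod_esymm n (partsOf t))]
  split_ifs with h
  · rw [← smul_eq_C_mul]
    refine Submodule.smul_mem _ _ (Submodule.subset_span ⟨⟨partsOf t, ?_, h.symm⟩, rfl⟩)
    intro i hi
    rw [partsOf, Multiset.mem_sum] at hi
    obtain ⟨j, -, hj⟩ := hi
    have := Multiset.mem_of_mem_nsmul hj
    rw [Multiset.mem_singleton] at this
    omega
  · simp

theorem count_partsOf {n : ℕ} (t : Fin n →₀ ℕ) (i : Fin n) :
    (partsOf t).count ((i : ℕ) + 1) = t i := by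
  simp [partsOf, Multiset.count_sum', Multiset.count_singleton, Fin.val_inj]

/-- Distinct partitions of `n` give distinct monomials in the algebraically independent `e_1, …,
e_n`. -/
theorem linearIndependent_esymmPart (n : ℕ) :
    LinearIndependent ℤ fun ν : n.Partition => esymmPart (Fin n) ℤ ν := by
  let T : n.Partition → (Fin n →₀ ℕ) := fun ν =>
    Finsupp.equivFunOnFinite.symm fun i => ν.parts.count ((i : ℕ) + 1)
  have hT : ∀ ν, partsOf (T ν) = ν.parts := by
    intro ν
    ext k
    by_cases hk : 0 < k ∧ k ≤ n
    · have := count_partsOf (T ν) ⟨k - 1, by omega⟩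
      simp only [Nat.sub_add_cancel hk.1] at this
      rw [this]
      simp [T, Nat.sub_add_cancel (Nat.succ_le_of_lt hk.1)]
    · rw [Multiset.count_eq_zero_of_notMem, Multiset.count_eq_zero_of_notMem]
      · intro h
        exact hk ⟨ν.parts_pos h, ν.parts_sum ▸ Multiset.le_sum_of_mem h⟩
      · intro h
        rw [partsOf, Multiset.mem_sum] at h
        obtain ⟨j, -, hj⟩ := h
        have := Multiset.mem_of_mem_nsmul hj
        rw [Multiset.mem_singleton] at this
        omega
  rw [Fintype.linearIndependent_iff]
  intro c hc ν
  have h0 : esymmAlgHom (Fin n) ℤ n (∑ ν, monomial (T ν) (c ν)) = 0 := by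
    apply Subtype.ext
    rw [map_sum, AddSubmonoidClass.coe_finsetSum, ZeroMemClass.coe_zero, ← hc]
    refine sum_congr rfl fun ν _ => ?_
    change esymmAlgHomMonomial (Fin n) _ _ = _
    rw [esymmAlgHomMonomial_eq, hT, smul_eq_C_mul, esymmPart]
  have h1 := (injective_iff_map_eq_zero _).1 (esymmAlgHom_fin_injective ℤ (le_refl n)) _ h0
  have h2 := congrArg (coeff (T ν)) h1
  have hinj : ∀ ν', T ν' = T ν ↔ ν' = ν := by
    refine fun ν' => ⟨fun h => ?_, fun h => h ▸ rfl⟩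
    apply Nat.Partition.ext
    rw [← hT, h, hT]
  rw [coeff_sum, coeff_zero] at h2
  simpa [coeff_monomial, hinj] using h2

/-- Both sides are homogeneous of degree `|V|`, and a monomial of that degree involves at most `|V|`
variables, so `|V|` variables detect equality. -/
theorem isElemExpansion_iff {V : Type*} [Fintype V] (G : SimpleGraph V)
    (c : Nat.Partition (Fintype.card V) → ℤ) :
    IsElemExpansion G c ↔ chromaticPoly G (Fintype.card V) =
      ∑ ν, c ν • esymmPart (Fin (Fintype.card V)) ℤ ν := by
  have hkill : ∀ {m : ℕ} (e : Fin m ↪ ℕ+),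
      MvPowerSeries.killCompl e (∑ ν, c ν • elemSymmPart ν) =
        MvPolynomial.coeToMvPowerSeries.ringHom (∑ ν, c ν • esymmPart (Fin m) ℤ ν) := by
    intro m e
    simp only [map_sum, map_zsmul, killCompl_elemSymmPart]
  constructor
  · intro h
    have e : Fin (Fintype.card V) ↪ ℕ+ :=
      (Fin.valEmbedding.trans Equiv.pnatEquivNat.symm.toEmbedding)
    have h1 := congrArg (MvPowerSeries.killCompl e) (show _ = _ from h)
    rw [hkill, killCompl_chromaticSymm] at h1
    exact coe_injective _ _ h1
  · intro h
    have hhom : ∀ m, (∑ ν, c ν • esymmPart (Fin m) ℤ ν).IsHomogeneous (Fintype.card V) := by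
      intro m
      refine IsHomogeneous.sum _ _ _ fun ν _ => ?_
      rw [smul_eq_C_mul]
      refine IsHomogeneous.C_mul ?_ _
      have := isHomogeneous_prod_esymm m ν.parts
      rwa [ν.parts_sum] at this
    have key : ∀ (m : ℕ) (α : Fin m →₀ ℕ),
        (α.degree = Fintype.card V → m = Fintype.card V) →
        coeff α (chromaticPoly G m) = coeff α (∑ ν, c ν • esymmPart (Fin m) ℤ ν) := by
      intro m α hα
      by_cases hd : α.degree = Fintype.card V
      · have := hα hd
        subst this
        rw [h]
      · rw [(isHomogeneous_chromaticPoly G m).coeff_eq_zero hd, (hhom m).coeff_eq_zero hd]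
    have main : ∀ (μ : ℕ+ →₀ ℕ) (m : ℕ), #μ.support ≤ m →
        (μ.degree = Fintype.card V → m = Fintype.card V) →
        MvPowerSeries.coeff μ (chromaticSymm G) =
          MvPowerSeries.coeff μ (∑ ν, c ν • elemSymmPart ν) := by
      intro μ m hm hd
      obtain ⟨T, hT, hTc⟩ := Infinite.exists_superset_card_eq μ.support m hm
      let e : Fin m ↪ ℕ+ :=
        (T.equivFinOfCardEq hTc).symm.toEmbedding.trans (Function.Embedding.subtype _)
      have hμ : μ ∈ Set.range (Finsupp.embDomain e) := by
        rw [Finsupp.mem_range_embDomain_iff]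
        intro i hi
        exact ⟨T.equivFinOfCardEq hTc ⟨i, hT hi⟩, by simp [e]⟩
      obtain ⟨α, rfl⟩ := hμ
      rw [← MvPowerSeries.coeff_killCompl, ← MvPowerSeries.coeff_killCompl, hkill,
        killCompl_chromaticSymm, coeToMvPowerSeries.ringHom_apply,
        coeToMvPowerSeries.ringHom_apply, coeff_coe, coeff_coe]
      exact key m α (by rwa [degree_embDomain] at hd)
    ext μ
    by_cases hd : μ.degree = Fintype.card V
    · refine main μ _ ?_ fun _ => rfl
      rw [← hd, Finsupp.degree, card_eq_sum_ones]
      exact sum_le_sum fun i hi => Nat.one_le_iff_ne_zero.2 (Finsupp.mem_support_iff.1 hi)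
    · exact main μ _ le_rfl fun h => absurd h hd

theorem existsUnique_isElemExpansion {V : Type*} [Fintype V] (G : SimpleGraph V) :
    ∃! c : Nat.Partition (Fintype.card V) → ℤ, IsElemExpansion G c := by
  obtain ⟨c, hc⟩ := (Submodule.mem_span_range_iff_exists_fun ℤ).1
    (mem_span_esymmPart (isSymmetric_chromaticPoly G _) (isHomogeneous_chromaticPoly G _))
  refine ⟨c, (isElemExpansion_iff G c).2 hc.symm, fun c' hc' => ?_⟩
  exact (linearIndependent_esymmPart _).fintypeLinearCombination_injective
    (((isElemExpansion_iff G c').1 hc').symm.trans hc.symm)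

/-- The sum of the coefficients of the `e_ν` with `ν₁ ≤ r` depends only on the chromatic symmetric
polynomial in `r` variables. -/
theorem sum_coeff_eq_cylFunctional {V : Type*} [Fintype V] (G : SimpleGraph V) (r : ℕ)
    {c : Nat.Partition (Fintype.card V) → ℤ} (hc : IsElemExpansion G c) :
    ∑ ν : Nat.Partition (Fintype.card V) with (∀ p ∈ ν.parts, p ≤ r), c ν =
      cylFunctional r (Fintype.card V) (chromaticPoly G r) := by
  have e : Fin r ↪ ℕ+ := (Fin.valEmbedding.trans Equiv.pnatEquivNat.symm.toEmbedding)
  have h1 := congrArg (MvPowerSeries.killCompl e) (show _ = _ from hc)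
  simp only [map_sum, map_zsmul, killCompl_elemSymmPart, killCompl_chromaticSymm] at h1
  simp only [← map_zsmul, ← map_sum] at h1
  rw [coe_injective _ _ h1, map_sum, sum_filter]
  refine sum_congr rfl fun ν _ => ?_
  have h2 := cylFunctional_prod_esymm r ν.parts
  rw [ν.parts_sum] at h2
  rw [map_zsmul, esymmPart, h2]
  split_ifs <;> simp

end CylindricTableaux

/-! ### Arrays of chains and the tail swap. -/

namespace CylindricTableaux

open Finset

/-! ### Arrays

A proper coloring of `inc(P)` with `r` colors splits `P` into `r` chains. The elements of the chain
with color `j` are put, in increasing order, into the positions `j, j + r, j + 2r, …`. -/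

/-- `f` gives the positions of the elements of `P` in an array of `r` chains. -/
structure IsArray {P : Type*} [PartialOrder P] (r : ℕ) (f : P → ℕ) : Prop where
  injective : Function.Injective f
  lt_of_add : ∀ p p', f p' = f p + r → p < p'
  exists_add : ∀ p, r ≤ f p → ∃ p', f p' + r = f p

/-- The array `f` has a flaw at `q`: position `q + 1` is filled, and position `q` is empty or has a
larger entry. -/
def HasFlaw {P : Type*} [PartialOrder P] (f : P → ℕ) (q : ℕ) : Prop :=
  ∃ p', f p' = q + 1 ∧ ∀ p, f p = q → p' < p

section Array

variable {P : Type*} [PartialOrder P] {r : ℕ} {f : P → ℕ}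

theorem IsArray.exists_add_mul (hf : IsArray r f) (k x : ℕ) (p : P) (h : f p = x + r * k) :
    ∃ p', f p' = x := by
  induction k generalizing p with
  | zero => exact ⟨p, by simpa using h⟩
  | succ k ih =>
    rw [mul_add, mul_one, ← add_assoc] at h
    obtain ⟨p', hp'⟩ := hf.exists_add p (by omega)
    exact ih p' (by omega)

theorem IsArray.lt_of_add_mul (hf : IsArray r f) (k : ℕ) (p p' : P)
    (h : f p' = f p + r * (k + 1)) : p < p' := by
  induction k generalizing p' with
  | zero => exact hf.lt_of_add p p' (by simpa using h)
  | succ k ih =>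
    rw [mul_add, mul_one, ← add_assoc] at h
    obtain ⟨p'', hp''⟩ := hf.exists_add p' (by omega)
    exact (ih p'' (by omega)).trans (hf.lt_of_add _ _ hp''.symm)

theorem IsArray.lt_of_mod_eq (hf : IsArray r f) {p p' : P} (h : f p % r = f p' % r)
    (hlt : f p < f p') : p < p' := by
  obtain ⟨k, hk⟩ := (Nat.modEq_iff_dvd' hlt.le).1 h
  rcases k with _ | k
  · simp at hk; omega
  · exact hf.lt_of_add_mul k p p' (by omega)

theorem IsArray.lt_iff (hf : IsArray r f) {p p' : P} (h : f p % r = f p' % r) :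
    p < p' ↔ f p < f p' := by
  refine ⟨fun hlt => ?_, hf.lt_of_mod_eq h⟩
  rcases lt_trichotomy (f p) (f p') with h' | h' | h'
  · exact h'
  · exact absurd (hf.injective h') hlt.ne
  · exact absurd (hf.lt_of_mod_eq h.symm h') hlt.asymm

/-- Columns have no gaps, so the row number of `p` counts the entries above it. -/
theorem IsArray.card_le [Fintype P] (hf : IsArray r f) (p : P) :
    #{p' | f p' % r = f p % r ∧ f p' ≤ f p} = f p / r + 1 := by
  classical
  -- For `r = 0` the conventions `x / 0 = 0` and `x % 0 = x` reduce the set to `{p}`.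
  rcases Nat.eq_zero_or_pos r with rfl | hr
  · rw [Nat.div_zero, zero_add, card_eq_one]
    refine ⟨p, ?_⟩
    ext p'
    simp only [mem_filter_univ, mem_singleton, Nat.mod_zero]
    exact ⟨fun h => hf.injective h.1, fun h => h ▸ ⟨rfl, le_rfl⟩⟩
  rw [← card_image_of_injective _ hf.injective, ← card_range (f p / r + 1),
    ← card_image_of_injective (range (f p / r + 1)) (f := fun i => f p % r + r * i)]
  · congr 1
    ext x
    simp only [mem_image, mem_filter_univ, mem_range]
    constructor
    · rintro ⟨p', ⟨h1, h2⟩, rfl⟩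
      refine ⟨f p' / r, Nat.lt_succ_of_le (Nat.div_le_div_right h2), ?_⟩
      rw [← h1, Nat.mod_add_div]
    · rintro ⟨i, hi, rfl⟩
      have h1 : f p = (f p % r + r * i) + r * (f p / r - i) := by
        rw [add_assoc, ← mul_add, Nat.add_sub_cancel' (by omega), Nat.mod_add_div]
      obtain ⟨p', hp'⟩ := hf.exists_add_mul _ _ p h1
      exact ⟨p', ⟨by simp [hp'], by omega⟩, hp'⟩
  · intro i j hij
    simpa [hr.ne'] using hij

/-- The exchange of the positions `q + kr` and `q + 1 + (k + 1)r`, for all `k`. -/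
noncomputable def tailSwap (r q x : ℕ) : ℕ :=
  open Classical in
  if ∃ k, x = q + r * k then x + (r + 1)
  else if ∃ k, x = q + 1 + r + r * k then x - (r + 1) else x

theorem tailSwap_left (r q k : ℕ) : tailSwap r q (q + r * k) = q + 1 + r + r * k := by
  rw [tailSwap, if_pos ⟨k, rfl⟩]; ring

theorem not_left_of_right (hr : 2 ≤ r) {q k k' : ℕ} : q + 1 + r + r * k ≠ q + r * k' := by
  intro h
  have h1 : r * k' = r * (k + 1) + 1 := by rw [mul_add, mul_one]; omega
  have h2 : r ∣ 1 := (Nat.dvd_add_right (Dvd.intro _ rfl)).1 (Dvd.intro _ h1)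
  have := Nat.le_of_dvd one_pos h2
  omega

theorem tailSwap_right (hr : 2 ≤ r) (q k : ℕ) : tailSwap r q (q + 1 + r + r * k) = q + r * k := by
  rw [tailSwap, if_neg, if_pos ⟨k, rfl⟩]
  · omega
  · rintro ⟨k', h⟩
    exact not_left_of_right hr h

theorem tailSwap_of_not {q x : ℕ} (h1 : ∀ k, x ≠ q + r * k) (h2 : ∀ k, x ≠ q + 1 + r + r * k) :
    tailSwap r q x = x := by
  rw [tailSwap, if_neg (by simpa using h1), if_neg (by simpa using h2)]

theorem tailSwap_of_lt {q x : ℕ} (h : x < q) : tailSwap r q x = x :=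
  tailSwap_of_not (fun k => by omega) (fun k => by omega)

theorem tailSwap_of_lt_lt {q x : ℕ} (h1 : q < x) (h2 : x < q + r) : tailSwap r q x = x := by
  refine tailSwap_of_not (fun k => ?_) (fun k => by omega)
  rcases k with _ | k
  · simp; omega
  · rw [mul_add]; omega

theorem tailSwap_involutive (hr : 2 ≤ r) (q : ℕ) : Function.Involutive (tailSwap r q) := by
  intro x
  by_cases h1 : ∃ k, x = q + r * k
  · obtain ⟨k, rfl⟩ := h1
    rw [tailSwap_left, tailSwap_right hr]
  by_cases h2 : ∃ k, x = q + 1 + r + r * k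
  · obtain ⟨k, rfl⟩ := h2
    rw [tailSwap_right hr, tailSwap_left]
  push Not at h1 h2
  rw [tailSwap_of_not h1 h2, tailSwap_of_not h1 h2]

/-- A flaw at `q`, and no flaw before `q - 1`. -/
structure IsEarlyFlaw (f : P → ℕ) (q : ℕ) : Prop where
  hasFlaw : HasFlaw f q
  not_hasFlaw : ∀ x, x + 1 < q → ¬ HasFlaw f x

/-- The box `q + 1 - r` above a filled box is filled. As `r ≥ 2`, position `q - r` lies before `q -
1` and has no flaw, so it is filled too, and by an entry not above its successor. -/
theorem IsArray.exists_before_flaw (hr : 2 ≤ r) (hf : IsArray r f) {q : ℕ} (hq : IsEarlyFlaw f q)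
    (h : r ≤ q) : ∃ a b c, f a + r = q ∧ f b + r = q + 1 ∧ f c = q + 1 ∧ b < c ∧ ¬ b < a := by
  obtain ⟨c, hc, -⟩ := hq.hasFlaw
  obtain ⟨b, hb⟩ := hf.exists_add c (by omega)
  have h1 := hq.not_hasFlaw (q - r) (by omega)
  simp only [HasFlaw, not_exists, not_and, not_forall] at h1
  obtain ⟨a, ha, ha'⟩ := h1 b (by omega)
  exact ⟨a, b, c, by omega, by omega, hc, hf.lt_of_add _ _ hb.symm, ha'⟩

/-- This is where freeness from `3+1` enters: below `b`, the right neighbour of `a`, the column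
continues as the chain `b < c < d`, and `a ≮ d` would make `a` incomparable to all three. -/
theorem IsArray.lt_of_flaw (hP : IsThreePlusOneFree P) (hr : 2 ≤ r) (hf : IsArray r f) {q : ℕ}
    (hq : IsEarlyFlaw f q) {a d : P} (ha : f a + r = q) (hd : f d = q + 1 + r) : a < d := by
  obtain ⟨a', b, c, ha', hb, hc, hbc, hba⟩ := hf.exists_before_flaw hr hq (by omega)
  obtain rfl : a = a' := hf.injective (by omega)
  have hcd : c < d := hf.lt_of_add _ _ (by omega)
  by_contra had
  have hne : ∀ {x y : P}, f x ≠ f y → x ≠ y := fun h h' => h (h' ▸ rfl)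
  have hab : ¬ a ≤ b := fun h => had ((h.trans_lt hbc).trans hcd)
  have hac : ¬ a ≤ c := fun h => had (h.trans_lt hcd)
  have had' : ¬ a ≤ d := fun h => had (h.lt_of_ne (hne (by omega)))
  have hba' : ¬ b ≤ a := fun h => hba (h.lt_of_ne (hne (by omega)))
  exact hP ⟨b, c, d, a, hbc, hcd, ⟨hba', hab⟩, ⟨fun h => hba' (hbc.le.trans h), hac⟩,
    ⟨fun h => hba' (hbc.le.trans (hcd.le.trans h)), had'⟩⟩

/-- The tails move rigidly, so only two junctions are new: `q - r` above the entry coming from `q +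
1 + r`, settled by `lt_of_flaw`, and `q + 1` above the entry coming from `q`, which is the flaw
itself. -/
theorem IsArray.tailSwap (hP : IsThreePlusOneFree P) (hr : 2 ≤ r) (hf : IsArray r f) {q : ℕ}
    (hq : IsEarlyFlaw f q) : IsArray r (fun p => tailSwap r q (f p)) := by
  have hinv := tailSwap_involutive hr q
  have hsw : ∀ {x y : ℕ}, CylindricTableaux.tailSwap r q x = y →
      x = CylindricTableaux.tailSwap r q y := fun h => h ▸ (hinv _).symm
  refine ⟨hinv.injective.comp hf.injective, fun p p' h => ?_, fun p h => ?_⟩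
  · replace h := hsw h
    by_cases h1 : ∃ k, f p = q + r * k
    · obtain ⟨k, hk⟩ := h1
      rw [hk, tailSwap_left, show q + 1 + r + r * k + r = q + 1 + r + r * (k + 1) by ring,
        tailSwap_right hr] at h
      exact hf.lt_of_add _ _ (by rw [h, hk]; ring)
    by_cases h2 : ∃ k, f p = q + 1 + r + r * k
    · obtain ⟨k, hk⟩ := h2
      rw [hk, tailSwap_right hr, show q + r * k + r = q + r * (k + 1) by ring,
        tailSwap_left] at h
      exact hf.lt_of_add _ _ (by rw [h, hk]; ring)
    push Not at h1 h2
    rw [tailSwap_of_not h1 h2] at h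
    by_cases h3 : ∃ k, f p + r = q + r * k
    · obtain ⟨k, hk⟩ := h3
      rcases k with _ | k
      · rw [hk, tailSwap_left] at h
        exact hf.lt_of_flaw hP hr hq (by simpa using hk) (by simpa using h)
      · exact absurd (by rw [mul_add] at hk; omega) (h1 k)
    by_cases h4 : ∃ k, f p + r = q + 1 + r + r * k
    · obtain ⟨k, hk⟩ := h4
      rcases k with _ | k
      · rw [hk, tailSwap_right hr] at h
        obtain ⟨c, hc, hc'⟩ := hq.hasFlaw
        obtain rfl : c = p := hf.injective (by omega)
        exact hc' p' (by simpa using h)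
      · exact absurd (by rw [mul_add] at hk; omega) (h2 k)
    push Not at h3 h4
    rw [tailSwap_of_not h3 h4] at h
    exact hf.lt_of_add _ _ h
  · suffices h' : ∃ p' y, f p' = CylindricTableaux.tailSwap r q y ∧
        y + r = CylindricTableaux.tailSwap r q (f p) by
      obtain ⟨p', y, hy, hy'⟩ := h'
      exact ⟨p', by rw [hy, hinv, hy']⟩
    by_cases h1 : ∃ k, f p = q + r * k
    · obtain ⟨k, hk⟩ := h1
      rw [hk, tailSwap_left]
      rcases k with _ | k
      · obtain ⟨c, hc, -⟩ := hq.hasFlaw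
        exact ⟨c, q + 1, by rw [hc, tailSwap_of_lt_lt (by omega) (by omega)], by ring⟩
      · obtain ⟨p', hp'⟩ := hf.exists_add p (by rw [hk, mul_add]; omega)
        refine ⟨p', q + 1 + r + r * k, ?_, by ring⟩
        rw [tailSwap_right hr]
        rw [hk, mul_add] at hp'
        omega
    by_cases h2 : ∃ k, f p = q + 1 + r + r * k
    · obtain ⟨k, hk⟩ := h2
      rw [hk, tailSwap_right hr] at h ⊢
      rcases k with _ | k
      · obtain ⟨a, b, c, ha, -⟩ := hf.exists_before_flaw hr hq (by simpa using h)
        exact ⟨a, f a, by rw [tailSwap_of_lt (by omega)], by simpa using ha⟩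
      · obtain ⟨p', hp'⟩ := hf.exists_add p (by rw [hk]; omega)
        refine ⟨p', q + r * k, ?_, by ring⟩
        rw [tailSwap_left]
        rw [hk, mul_add] at hp'
        omega
    push Not at h1 h2
    rw [tailSwap_of_not h1 h2] at h ⊢
    obtain ⟨p', hp'⟩ := hf.exists_add p h
    refine ⟨p', f p', ?_, hp'⟩
    rw [tailSwap_of_not]
    · intro k hk
      exact h1 (k + 1) (by rw [mul_add]; omega)
    · intro k hk
      exact h2 (k + 1) (by rw [mul_add]; omega)

/-! ### Effect of the tail swap on flaws, chain sizes and signs. -/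

theorem hasFlaw_congr {g : P → ℕ} {x : ℕ} (h : ∀ p, g p = x ↔ f p = x)
    (h' : ∀ p, g p = x + 1 ↔ f p = x + 1) : HasFlaw g x ↔ HasFlaw f x := by
  simp only [HasFlaw, h, h']

theorem tailSwap_eq_iff (hr : 2 ≤ r) {q x y : ℕ} (hx : tailSwap r q x = x) :
    tailSwap r q y = x ↔ y = x :=
  ⟨fun h => (tailSwap_involutive hr q).injective (h.trans hx.symm), fun h => h ▸ hx⟩

theorem hasFlaw_tailSwap_of_lt (hr : 2 ≤ r) {q x : ℕ} (hx : x + 1 < q) :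
    HasFlaw (fun p => tailSwap r q (f p)) x ↔ HasFlaw f x :=
  hasFlaw_congr (fun _ => tailSwap_eq_iff hr (tailSwap_of_lt (by omega)))
    (fun _ => tailSwap_eq_iff hr (tailSwap_of_lt hx))

theorem hasFlaw_tailSwap_of_gt (hr : 2 ≤ r) {q x : ℕ} (hx : q < x) (hx' : x + 1 < q + r) :
    HasFlaw (fun p => tailSwap r q (f p)) x ↔ HasFlaw f x :=
  hasFlaw_congr (fun _ => tailSwap_eq_iff hr (tailSwap_of_lt_lt hx (by omega)))
    (fun _ => tailSwap_eq_iff hr (tailSwap_of_lt_lt (by omega) hx'))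

/-- The entry at `q + 1` stays, while box `q` receives the former entry below it, which is larger,
or becomes empty. -/
theorem IsArray.isEarlyFlaw_tailSwap (hr : 2 ≤ r) (hf : IsArray r f) {q : ℕ}
    (hq : IsEarlyFlaw f q) : IsEarlyFlaw (fun p => CylindricTableaux.tailSwap r q (f p)) q := by
  refine ⟨?_, fun x hx => by rw [hasFlaw_tailSwap_of_lt hr hx]; exact hq.not_hasFlaw x hx⟩
  obtain ⟨c, hc, -⟩ := hq.hasFlaw
  refine ⟨c, ?_, fun p hp => ?_⟩
  · change CylindricTableaux.tailSwap r q (f c) = _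
    rw [hc, tailSwap_of_lt_lt (by omega) (by omega)]
  · have h1 := (tailSwap_involutive hr q) (f p)
    change CylindricTableaux.tailSwap r q (f p) = q at hp
    rw [hp] at h1
    have h2 := tailSwap_left r q 0
    simp only [mul_zero, add_zero] at h2
    exact hf.lt_of_add _ _ (by omega)

/-- The sizes of the chains of an array. -/
noncomputable def chainSizes [Fintype P] (r : ℕ) (f : P → ℕ) (j : Fin r) : ℕ := #{p | f p % r = j}

/-- All `q / r` boxes above `q` in its column are filled, by `exists_before_flaw`; the other entries
form the moving tail. -/
theorem IsArray.chainSizes_left [Fintype P] (hr : 2 ≤ r) (hf : IsArray r f) {q : ℕ}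
    (hq : IsEarlyFlaw f q) : #{p | f p % r = q % r} =
      q / r + Nat.card {p | ∃ k, f p = q + r * k} := by
  classical
  rw [Nat.card_eq_fintype_card, Fintype.card_subtype,
    ← card_filter_add_card_filter_not (fun p => f p < q), filter_filter, filter_filter]
  congr 1
  · rcases lt_or_ge q r with h | h
    · rw [Nat.div_eq_of_lt h, card_eq_zero, filter_eq_empty_iff]
      rintro p - ⟨h1, h2⟩
      rw [Nat.mod_eq_of_lt h, Nat.mod_eq_of_lt (by omega)] at h1
      omega
    · obtain ⟨a, b, c, ha, -⟩ := hf.exists_before_flaw hr hq h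
      have h1 := hf.card_le a
      rw [← ha, Nat.add_div_right _ (by omega), ← h1, Nat.add_mod_right]
      congr 1
      ext p
      simp only [mem_filter_univ]
      refine and_congr_right fun hp => ⟨fun hlt => ?_, fun hle => by omega⟩
      by_contra hle
      obtain ⟨k, hk⟩ := (Nat.modEq_iff_dvd' (not_le.1 hle).le).1 hp.symm
      rcases k with _ | k
      · simp at hk; omega
      · rw [mul_add] at hk; omega
  · congr 1
    ext p
    simp only [mem_filter_univ, Set.mem_ofPred_eq, not_lt]
    constructor
    · rintro ⟨h1, h2⟩
      obtain ⟨k, hk⟩ := (Nat.modEq_iff_dvd' h2).1 h1.symm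
      exact ⟨k, by omega⟩
    · rintro ⟨k, hk⟩
      simp [hk]

/-- The box `q + 1` is filled and does not move, whence the extra `1`. -/
theorem IsArray.chainSizes_right [Fintype P] (hr : 2 ≤ r) (hf : IsArray r f) {q : ℕ}
    (hq : IsEarlyFlaw f q) : #{p | f p % r = (q + 1) % r} =
      (q + 1) / r + 1 + Nat.card {p | ∃ k, f p = q + 1 + r + r * k} := by
  classical
  obtain ⟨c, hc, -⟩ := hq.hasFlaw
  rw [Nat.card_eq_fintype_card, Fintype.card_subtype,
    ← card_filter_add_card_filter_not (fun p => f p ≤ q + 1), filter_filter, filter_filter]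
  congr 1
  · rw [← hc]
    exact hf.card_le c
  · congr 1
    ext p
    simp only [mem_filter_univ, Set.mem_ofPred_eq, not_le]
    constructor
    · rintro ⟨h1, h2⟩
      obtain ⟨k, hk⟩ := (Nat.modEq_iff_dvd' h2.le).1 h1.symm
      rcases k with _ | k
      · simp at hk; omega
      · exact ⟨k, by rw [mul_add] at hk; omega⟩
    · rintro ⟨k, hk⟩
      constructor
      · rw [hk, show q + 1 + r + r * k = q + 1 + r * (k + 1) by ring, Nat.add_mul_mod_self_left]
      · omega

/-- Because `r = -1` modulo `r + 1`: the residue of a column filled exactly down to just above `q`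
is `q`. -/
theorem natCast_mod_sub_div (r q : ℕ) :
    ((q % r : ℕ) : ZMod (r + 1)) - ((q / r : ℕ) : ZMod (r + 1)) = q := by
  have h1 : ((r : ℕ) : ZMod (r + 1)) + 1 = 0 := by exact_mod_cast ZMod.natCast_self (r + 1)
  have h2 : ((q % r : ℕ) : ZMod (r + 1)) + (r : ℕ) * (q / r : ℕ) = q := by
    exact_mod_cast congrArg (fun x : ℕ => (x : ZMod (r + 1))) (Nat.mod_add_div q r)
  linear_combination h2 - ((q / r : ℕ) : ZMod (r + 1)) * h1

theorem mod_ne_succ_mod (hr : 2 ≤ r) (q : ℕ) : q % r ≠ (q + 1) % r := by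
  intro h
  have h1 := (Nat.modEq_iff_dvd' (Nat.le_succ q)).1 h
  simp at h1
  omega

/-- If the tails have sizes `L` and `R`, the residues of the two columns are `q - L` and `(q + 1) -
1 - R = q - R`. The swap exchanges `L` and `R`, hence these residues. -/
theorem IsArray.cylWeight_tailSwap [Fintype P] (hP : IsThreePlusOneFree P) (hr : 2 ≤ r)
    (hf : IsArray r f) (n : ℕ) {q : ℕ} (hq : IsEarlyFlaw f q) :
    cylWeight n (chainSizes r fun p => CylindricTableaux.tailSwap r q (f p)) =
      -cylWeight n (chainSizes r f) := by
  classical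
  set g : P → ℕ := fun p => CylindricTableaux.tailSwap r q (f p) with hg
  have hgA : IsArray r g := hf.tailSwap hP hr hq
  have hgq : IsEarlyFlaw g q := hf.isEarlyFlaw_tailSwap hr hq
  have hinv := tailSwap_involutive hr q
  have hAC : ∀ p, (∃ k, g p = q + r * k) ↔ ∃ k, f p = q + 1 + r + r * k := by
    refine fun p => exists_congr fun k => ?_
    rw [hg, ← tailSwap_right hr]
    exact hinv.injective.eq_iff
  have hCA : ∀ p, (∃ k, g p = q + 1 + r + r * k) ↔ ∃ k, f p = q + r * k := by
    refine fun p => exists_congr fun k => ?_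
    rw [hg, ← tailSwap_left]
    exact hinv.injective.eq_iff
  have hfa := hf.chainSizes_left hr hq
  have hfb := hf.chainSizes_right hr hq
  have hga := hgA.chainSizes_left hr hgq
  have hgb := hgA.chainSizes_right hr hgq
  simp only [hAC] at hga
  simp only [hCA] at hgb
  have hother : ∀ j, j ≠ q % r → j ≠ (q + 1) % r → ∀ p, g p % r = j ↔ f p % r = j := by
    intro j hja hjb p
    by_cases h1 : ∃ k, f p = q + r * k
    · obtain ⟨k, hk⟩ := h1
      rw [hg, hk]
      dsimp only
      rw [hk, tailSwap_left, show q + 1 + r + r * k = q + 1 + r * (k + 1) by ring,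
        Nat.add_mul_mod_self_left, Nat.add_mul_mod_self_left]
      exact iff_of_false hjb.symm hja.symm
    by_cases h2 : ∃ k, f p = q + 1 + r + r * k
    · obtain ⟨k, hk⟩ := h2
      rw [hg, hk]
      dsimp only
      rw [hk, tailSwap_right hr, show q + 1 + r + r * k = q + 1 + r * (k + 1) by ring,
        Nat.add_mul_mod_self_left, Nat.add_mul_mod_self_left]
      exact iff_of_false hja.symm hjb.symm
    push Not at h1 h2
    rw [hg]
    dsimp only
    rw [tailSwap_of_not h1 h2]
  have hne := mod_ne_succ_mod hr q
  have hlt : ∀ x, x % r < r := fun x => Nat.mod_lt x (by omega)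
  let a : Fin r := ⟨q % r, hlt q⟩
  let b : Fin r := ⟨(q + 1) % r, hlt _⟩
  have hab : a ≠ b := fun h => hne (congrArg Fin.val h)
  have hab' : a.castSucc ≠ b.castSucc := fun h => hab (Fin.castSucc_injective _ h)
  have ea := natCast_mod_sub_div r q
  have eb := natCast_mod_sub_div r (q + 1)
  rw [cylWeight, cylWeight, ← mul_neg, ← funSign_comp_swap _ hab']
  congr 2
  refine residues_ext (fun j => ?_) ?_
  · by_cases hja : j = a
    · subst hja
      rw [Equiv.swap_apply_left, residues_castSucc]
      simp only [chainSizes, a, b, hfb, hga]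
      push_cast at ea eb ⊢
      linear_combination eb - ea
    by_cases hjb : j = b
    · subst hjb
      rw [Equiv.swap_apply_right, residues_castSucc]
      simp only [chainSizes, a, b, hfa, hgb]
      push_cast at ea eb ⊢
      linear_combination ea - eb
    rw [Equiv.swap_apply_of_ne_of_ne (by simpa using hja) (by simpa using hjb), residues_castSucc]
    congr 2
    simp only [chainSizes]
    congr 1
    ext p
    simp only [mem_filter_univ]
    exact (hother j (fun h => hja (Fin.ext h)) (fun h => hjb (Fin.ext h)) p).symm
  · rw [Equiv.swap_apply_of_ne_of_ne (Fin.castSucc_ne_last _).symm (Fin.castSucc_ne_last _).symm,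
      residues_last]

end Array

end CylindricTableaux

/-! ### The signed count of colorings reduces to arrays without flaws. -/

namespace CylindricTableaux

open Finset

/-! ### Cancellation of the arrays with flaws -/

section Cancellation

variable {P : Type*} [PartialOrder P] {r : ℕ} {f : P → ℕ}

/-- Along such a run the entries decrease from `q` to `q + r`, yet `q + r` lies directly below `q`
in the same chain. -/
theorem IsArray.not_forall_hasFlaw (hr : 0 < r) (hf : IsArray r f) (q : ℕ) :
    ¬ ∀ i < r, HasFlaw f (q + i) := by
  intro h
  obtain ⟨p1, hp1, -⟩ := h (r - 1) (by omega)
  obtain ⟨p0, hp0⟩ := hf.exists_add p1 (by omega)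
  have key : ∀ i ≤ r, ∃ p, f p = q + i ∧ p ≤ p0 := by
    intro i
    induction i with
    | zero => exact fun _ => ⟨p0, by omega, le_rfl⟩
    | succ i ih =>
      intro hi
      obtain ⟨p, hp, hle⟩ := ih (by omega)
      obtain ⟨p', hp', hlt⟩ := h i (by omega)
      exact ⟨p', by omega, (hlt p hp).le.trans hle⟩
  obtain ⟨p, hp, hle⟩ := key r le_rfl
  obtain rfl : p = p1 := hf.injective (by omega)
  exact absurd (hf.lt_of_add p0 p (by omega)) hle.not_gt

variable [Fintype P]

variable (P r) in
open Classical in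
/-- The finite set of all arrays of `r` chains. -/
noncomputable def arrays : Finset (P → ℕ) :=
  {f ∈ Fintype.piFinset fun _ : P => range (r * Fintype.card P) | IsArray r f}

theorem mem_arrays (hr : 0 < r) : f ∈ arrays P r ↔ IsArray r f := by
  classical
  rw [arrays, mem_filter, Fintype.mem_piFinset, and_iff_right_iff_imp]
  intro hf p
  have h1 := hf.card_le p
  have h2 := card_le_univ (filter (fun p' => f p' % r = f p % r ∧ f p' ≤ f p) univ)
  rw [mem_range, mul_comm, ← Nat.div_lt_iff_lt_mul hr]
  omega

theorem lt_of_hasFlaw (hf : f ∈ arrays P r) {q : ℕ} (hq : HasFlaw f q) :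
    q < r * Fintype.card P := by
  classical
  obtain ⟨p, hp, -⟩ := hq
  rw [arrays, mem_filter, Fintype.mem_piFinset] at hf
  have := mem_range.1 (hf.1 p)
  omega

open Classical in
-- The tail swap at `q` is a sign-reversing involution here: since `k < r`, it fixes the boxes `q +
-- 1, …, q + k`, so the rest of the run survives.
theorem sum_isEarlyFlaw (hP : IsThreePlusOneFree P) (n q k : ℕ) (hk : 0 < k) (hkr : k < r) :
    ∑ f ∈ arrays P r with (∀ x, x + 1 < q → ¬ HasFlaw f x) ∧ ∀ i < k, HasFlaw f (q + i),
      cylWeight n (chainSizes r f) = 0 := by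
  have hr : 2 ≤ r := by omega
  refine sum_involution (fun f _ => fun p => tailSwap r q (f p)) ?_ ?_ ?_ ?_
  · intro f hf
    rw [mem_filter, mem_arrays (by omega)] at hf
    have hq : IsEarlyFlaw f q := ⟨hf.2.2 0 hk, hf.2.1⟩
    rw [hf.1.cylWeight_tailSwap hP hr n hq, add_neg_cancel]
  · intro f hf h0 heq
    rw [mem_filter, mem_arrays (by omega)] at hf
    have hq : IsEarlyFlaw f q := ⟨hf.2.2 0 hk, hf.2.1⟩
    have := hf.1.cylWeight_tailSwap hP hr n hq
    rw [heq] at this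
    omega
  · intro f hf
    rw [mem_filter, mem_arrays (by omega)] at hf ⊢
    have hq : IsEarlyFlaw f q := ⟨hf.2.2 0 hk, hf.2.1⟩
    have hq' := hf.1.isEarlyFlaw_tailSwap hr hq
    refine ⟨hf.1.tailSwap hP hr hq, hq'.not_hasFlaw, fun i hi => ?_⟩
    rcases Nat.eq_zero_or_pos i with rfl | hi0
    · exact hq'.hasFlaw
    · rw [hasFlaw_tailSwap_of_gt hr (by omega) (by omega)]
      exact hf.2.2 i hi
  · intro f _
    funext p
    exact tailSwap_involutive hr q (f p)

open Classical in
-- Split the sum of `sum_isEarlyFlaw` at `q + 1` by whether `q` has a flaw. Arrays with one have a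
-- run of length `k + 1` from `q`, handled by induction on `q`; the others form the desired sum.
-- Quantifying over all `k ≤ r` is what lets the run grow.
theorem sum_hasFlaw_run (hP : IsThreePlusOneFree P) (hr : 0 < r) (n q : ℕ) :
    ∀ k, 0 < k → k ≤ r →
      ∑ f ∈ arrays P r with (∀ x < q, ¬ HasFlaw f x) ∧ ∀ i < k, HasFlaw f (q + i),
        cylWeight n (chainSizes r f) = 0 := by
  induction q with
  | zero =>
    intro k hk hkr
    rcases hkr.lt_or_eq with h | rfl
    · simpa using sum_isEarlyFlaw hP n 0 k hk h
    · refine sum_eq_zero fun f hf => ?_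
      rw [mem_filter, mem_arrays hr] at hf
      exact absurd hf.2.2 (hf.1.not_forall_hasFlaw hr 0)
  | succ q ih =>
    intro k hk hkr
    rcases hkr.lt_or_eq with h | rfl
    · have h1 := sum_isEarlyFlaw hP n (q + 1) k hk h
      rw [← sum_filter_add_sum_filter_not _ (fun f => HasFlaw f q), filter_filter,
        filter_filter] at h1
      rw [← h1, ← zero_add (∑ f ∈ _, _)]
      congr 1
      · rw [← ih (k + 1) (by omega) (by omega)]
        refine sum_congr (filter_congr fun f _ => ?_) fun _ _ => rfl
        constructor
        · rintro ⟨h2, h3⟩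
          refine ⟨⟨fun x hx => h2 x (by omega), fun i hi => ?_⟩, h3 0 (by omega)⟩
          have := h3 (i + 1) (by omega)
          rwa [← add_assoc, add_right_comm] at this
        · rintro ⟨⟨h2, h3⟩, h4⟩
          refine ⟨fun x hx => h2 x (by omega), fun i hi => ?_⟩
          rcases i with _ | i
          · exact h4
          · have := h3 i (by omega)
            rwa [add_right_comm, add_assoc] at this
      · refine sum_congr (filter_congr fun f _ => ?_) fun _ _ => rfl
        constructor
        · rintro ⟨h2, h3⟩
          exact ⟨⟨fun x hx => h2 x (by omega), h3⟩, h2 q (by omega)⟩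
        · rintro ⟨⟨h2, h3⟩, h4⟩
          refine ⟨fun x hx => ?_, h3⟩
          rcases (Nat.lt_succ_iff.1 hx).lt_or_eq with h5 | rfl
          · exact h2 x (by omega)
          · exact h4
    · refine sum_eq_zero fun f hf => ?_
      rw [mem_filter, mem_arrays hr] at hf
      exact absurd hf.2.2 (hf.1.not_forall_hasFlaw hr _)

open Classical in
/-- In the signed sum over all arrays, those with a flaw cancel. -/
theorem sum_arrays_eq (hP : IsThreePlusOneFree P) (hr : 0 < r) (n : ℕ) :
    ∑ f ∈ arrays P r, cylWeight n (chainSizes r f) =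
      ∑ f ∈ arrays P r with ∀ x, ¬ HasFlaw f x, cylWeight n (chainSizes r f) := by
  have key : ∀ q, ∑ f ∈ arrays P r, cylWeight n (chainSizes r f) =
      ∑ f ∈ arrays P r with ∀ x < q, ¬ HasFlaw f x, cylWeight n (chainSizes r f) := by
    intro q
    induction q with
    | zero => simp
    | succ q ih =>
      have h1 := sum_hasFlaw_run hP hr n q 1 one_pos hr
      rw [ih, ← sum_filter_add_sum_filter_not _ (fun f => HasFlaw f q), filter_filter,
        filter_filter]
      have h2 : ∀ f : P → ℕ, (∀ i < 1, HasFlaw f (q + i)) ↔ HasFlaw f q := by simp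
      simp only [h2] at h1
      rw [h1, zero_add]
      refine sum_congr (filter_congr fun f _ => ?_) fun _ _ => rfl
      rw [Nat.forall_lt_succ_right]
  -- All positions of an array lie below this bound, so no flaw occurs beyond it.
  rw [key (r * Fintype.card P)]
  refine sum_congr (filter_congr fun f hf => ?_) fun _ _ => rfl
  exact ⟨fun h x hx => h x (lt_of_hasFlaw hf hx) hx, fun h x _ => h x⟩

/-! ### Arrays without flaws -/

/-- An empty box followed by a filled one is a flaw, so the filled boxes form an initial segment. -/
theorem exists_eq_iff_of_not_hasFlaw (hf : Function.Injective f) (h : ∀ x, ¬ HasFlaw f x) (x : ℕ) :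
    (∃ p, f p = x) ↔ x < Fintype.card P := by
  classical
  have hdown : ∀ p, ∀ y ≤ f p, ∃ p', f p' = y := by
    intro p y hy
    induction hy using Nat.decreasingInduction with
    | self => exact ⟨p, rfl⟩
    | of_succ k hk ih =>
      obtain ⟨p', hp'⟩ := ih
      by_contra hne
      push Not at hne
      exact h k ⟨p', hp', fun p hp => absurd hp (hne p)⟩
  have hsub : univ.image f ⊆ range (Fintype.card P) := by
    intro y hy
    obtain ⟨p, -, rfl⟩ := mem_image.1 hy
    have h1 : range (f p + 1) ⊆ univ.image f := by
      intro y hy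
      obtain ⟨p', hp'⟩ := hdown p y (Nat.lt_succ_iff.1 (mem_range.1 hy))
      exact mem_image.2 ⟨p', mem_univ _, hp'⟩
    have h2 := card_le_card h1
    rw [card_range, card_image_of_injective _ hf, card_univ] at h2
    exact mem_range.2 h2
  have heq := eq_of_subset_of_card_le hsub (by
    rw [card_image_of_injective _ hf, card_univ, card_range])
  rw [← mem_range, ← heq]
  simp

/-- Filling box `n` turns the residue `n` of its column into `n - 1`, and the last residue from `r +
n = n - 1` into `n`. This transposition cancels the sign change of `(-1)^n`. -/
theorem cylWeight_count (hr : 0 < r) (n : ℕ) :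
    cylWeight n (fun j : Fin r => #{x ∈ range n | x % r = j}) = 1 := by
  induction n with
  | zero => exact cylWeight_zero r
  | succ n ih =>
    have hlt := Nat.mod_lt n hr
    let a : Fin r := ⟨n % r, hlt⟩
    have hcard : #{x ∈ range n | x % r = n % r} = n / r := by
      have h1 := Nat.count_modEq_card n hr n
      rw [if_neg (lt_irrefl _), add_zero, Nat.count_eq_card_filter_range] at h1
      exact h1
    have h1 : ((r : ℕ) : ZMod (r + 1)) + 1 = 0 := by exact_mod_cast ZMod.natCast_self (r + 1)
    have e := natCast_mod_sub_div r n
    rw [← ih, cylWeight, cylWeight, pow_succ, mul_assoc, neg_one_mul]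
    congr 1
    rw [neg_eq_iff_eq_neg, ← funSign_comp_swap _ (Fin.castSucc_ne_last a)]
    congr 1
    refine residues_ext (fun j => ?_) ?_
    · rw [range_add_one, filter_insert]
      by_cases hja : j = a
      · subst hja
        rw [Equiv.swap_apply_left, residues_last, if_pos rfl, card_insert_of_notMem (by simp)]
        change _ = ((n % r : ℕ) : ZMod (r + 1)) -
          ((#{x ∈ range n | x % r = n % r} + 1 : ℕ) : ZMod (r + 1))
        rw [hcard]
        push_cast at e h1 ⊢
        linear_combination h1 - e
      · rw [Equiv.swap_apply_of_ne_of_ne (by simpa using hja) (Fin.castSucc_ne_last _),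
          residues_castSucc, if_neg fun h => hja (Fin.ext h.symm)]
    · rw [Equiv.swap_apply_right, residues_castSucc]
      simp only [a, hcard]
      push_cast at e h1 ⊢
      linear_combination e - h1

theorem cylWeight_of_not_hasFlaw (hr : 0 < r) (hf : Function.Injective f)
    (h : ∀ x, ¬ HasFlaw f x) : cylWeight (Fintype.card P) (chainSizes r f) = 1 := by
  classical
  rw [← cylWeight_count hr (Fintype.card P)]
  congr 1
  funext j
  rw [chainSizes, ← card_image_of_injective _ hf]
  congr 1
  ext x
  rw [mem_filter, mem_range, ← exists_eq_iff_of_not_hasFlaw hf h]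
  simp only [mem_image, mem_filter_univ]
  constructor
  · rintro ⟨p, hp, rfl⟩
    exact ⟨⟨p, rfl⟩, hp⟩
  · rintro ⟨⟨p, rfl⟩, hp⟩
    exact ⟨p, hp, rfl⟩

/-! ### Arrays and proper colorings -/

/-- Color classes are chains in `P`; the row of an element is the number of smaller elements in its
class. -/
theorem exists_isArray_mod_eq (κ : P → Fin r) (hκ : ∀ a b, (incGraph P).Adj a b → κ a ≠ κ b) :
    ∃ f, IsArray r f ∧ ∀ p, f p % r = κ p := by
  classical
  let rk : P → ℕ := fun p => #{p' | κ p' = κ p ∧ p' < p}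
  have hcomp : ∀ {p p'}, κ p = κ p' → p ≠ p' → p < p' ∨ p' < p := by
    intro p p' h hne
    by_contra hlt
    push Not at hlt
    refine hκ p p' ⟨fun hle => hlt.1 (hle.lt_of_ne hne), fun hle => hlt.2 (hle.lt_of_ne hne.symm)⟩ h
  have hmono : ∀ {p p'}, κ p = κ p' → p < p' → rk p < rk p' := by
    intro p p' h hlt
    refine card_lt_card ((ssubset_iff_of_subset fun x hx => ?_).2 ⟨p, ?_, ?_⟩)
    · simp only [mem_filter_univ] at hx ⊢
      exact ⟨hx.1.trans h, hx.2.trans hlt⟩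
    · simpa [mem_filter_univ] using ⟨h, hlt⟩
    · simp
  have hmod : ∀ p, ((κ p : ℕ) + r * rk p) % r = κ p := by
    intro p
    rw [Nat.add_mul_mod_self_left, Nat.mod_eq_of_lt (κ p).2]
  have hκeq : ∀ {p p' k}, (κ p' : ℕ) + r * rk p' = (κ p + r * rk p) + r * k →
      κ p = κ p' ∧ rk p' = rk p + k := by
    intro p p' k h
    have h1 : κ p = κ p' := by
      apply Fin.ext
      rw [← hmod p, ← hmod p', h, Nat.add_mul_mod_self_left,
        Nat.add_mul_mod_self_left, Nat.add_mul_mod_self_left]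
    refine ⟨h1, ?_⟩
    rw [h1, add_assoc, Nat.add_left_cancel_iff, ← mul_add] at h
    exact Nat.eq_of_mul_eq_mul_left (Fin.pos (κ p)) h
  refine ⟨fun p => κ p + r * rk p, ⟨?_, ?_, ?_⟩, hmod⟩
  · intro p p' h
    obtain ⟨h1, h2⟩ := hκeq (k := 0) (p := p') (p' := p) (by simpa using h)
    by_contra hne
    rcases hcomp h1.symm hne with hlt | hlt
    · exact absurd (hmono h1.symm hlt) (by omega)
    · exact absurd (hmono h1 hlt) (by omega)
  · intro p p' h
    obtain ⟨h1, h2⟩ := hκeq (k := 1) (by simpa using h)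
    rcases hcomp h1 (by rintro rfl; omega) with hlt | hlt
    · exact hlt
    · exact absurd (hmono h1.symm hlt) (by omega)
  · intro p h
    have hpos : rk p ≠ 0 := by
      intro h0
      have := (κ p).2
      simp only [h0, mul_zero, add_zero] at h
      omega
    -- A maximal smaller element of the class is the immediate predecessor of `p`, so it has rank
    -- one less.
    obtain ⟨p', hp', hmax⟩ := exists_maximal (card_ne_zero.1 hpos)
    simp only [mem_filter_univ] at hp' hmax
    refine ⟨p', ?_⟩
    have h1 : rk p = rk p' + 1 := by
      rw [← card_insert_of_notMem (s := {p'' | κ p'' = κ p' ∧ p'' < p'}) (a := p') (by simp)]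
      refine congrArg card (Finset.ext fun x => ?_)
      simp only [mem_insert, mem_filter_univ, hp'.1]
      constructor
      · rintro ⟨hx1, hx2⟩
        by_cases hx : x = p'
        · exact Or.inl hx
        · rcases hcomp (hx1.trans hp'.1.symm) hx with hlt | hlt
          · exact Or.inr ⟨hx1, hlt⟩
          · exact absurd (hmax ⟨hx1, hx2⟩ hlt.le) hlt.not_ge
      · rintro (rfl | ⟨hx1, hx2⟩)
        · exact hp'
        · exact ⟨hx1, hx2.trans hp'.2⟩
    simp only [h1, hp'.1]
    ring

/-- By `card_le` the row of `p` is found by counting the elements of its chain up to `p`, which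
depends on the columns only. -/
theorem IsArray.ext_of_mod_eq {g : P → ℕ} (hf : IsArray r f) (hg : IsArray r g)
    (h : ∀ p, f p % r = g p % r) : f = g := by
  classical
  funext p
  have h1 := hf.card_le p
  have h2 := hg.card_le p
  have h3 : #{p' | f p' % r = f p % r ∧ f p' ≤ f p} = #{p' | g p' % r = g p % r ∧ g p' ≤ g p} := by
    congr 1
    ext p'
    simp only [mem_filter_univ, h]
    refine and_congr_right fun hp => ?_
    rw [← not_lt, ← not_lt, ← hf.lt_iff (by rw [h, h, hp]), ← hg.lt_iff hp.symm]
  rw [← Nat.mod_add_div (f p) r, ← Nat.mod_add_div (g p) r, h, show f p / r = g p / r by omega]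

theorem cylFunctional_chromaticPoly (hr : 0 < r) (n : ℕ) :
    cylFunctional r n (chromaticPoly (incGraph P) r) =
      ∑ f ∈ arrays P r, cylWeight n (chainSizes r f) := by
  classical
  rw [chromaticPoly, map_sum]
  symm
  refine sum_bij (fun f _ p => ⟨f p % r, Nat.mod_lt _ hr⟩) ?_ ?_ ?_ ?_
  · intro f hf
    rw [mem_arrays hr] at hf
    rw [mem_filter_univ]
    intro a b hab h
    have h1 : f a % r = f b % r := congrArg Fin.val h
    rcases lt_trichotomy (f a) (f b) with hlt | heq | hlt
    · exact hab.1 (hf.lt_of_mod_eq h1 hlt).le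
    · exact hab.1 (hf.injective heq).le
    · exact hab.2 (hf.lt_of_mod_eq h1.symm hlt).le
  · intro f hf g hg h
    rw [mem_arrays hr] at hf hg
    exact hf.ext_of_mod_eq hg fun p => congrArg Fin.val (congrFun h p)
  · intro κ hκ
    rw [mem_filter_univ] at hκ
    obtain ⟨f, hf, hfκ⟩ := exists_isArray_mod_eq κ hκ
    exact ⟨f, (mem_arrays hr).2 hf, funext fun p => Fin.ext (hfκ p)⟩
  · intro f _
    rw [cylFunctional_monomial]
    congr 1
    funext j
    rw [Finsupp.finsetSum_apply, chainSizes, card_filter]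
    refine sum_congr rfl fun p _ => ?_
    rw [Finsupp.single_apply]
    congr 1
    rw [Fin.ext_iff]

/-- The sum of the coefficients `c_ν` with `ν₁ ≤ r` is the number of arrays without flaws. -/
theorem sum_coeff_eq_ncard (hP : IsThreePlusOneFree P) (hr : 0 < r)
    {c : Nat.Partition (Fintype.card P) → ℤ} (hc : IsElemExpansion (incGraph P) c) :
    ∑ ν : Nat.Partition (Fintype.card P) with (∀ p ∈ ν.parts, p ≤ r), c ν =
      ({f : P → ℕ | IsArray r f ∧ ∀ x, ¬ HasFlaw f x}.ncard : ℤ) := by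
  classical
  rw [sum_coeff_eq_cylFunctional _ r hc, cylFunctional_chromaticPoly hr, sum_arrays_eq hP hr]
  have h1 : {f : P → ℕ | IsArray r f ∧ ∀ x, ¬ HasFlaw f x} =
      ((arrays P r).filter fun f => ∀ x, ¬ HasFlaw f x : Finset (P → ℕ)) := by
    ext f
    simp [mem_arrays hr]
  rw [h1, Set.ncard_coe_finset, card_eq_sum_ones, Nat.cast_sum]
  refine sum_congr rfl fun f hf => ?_
  rw [mem_filter, mem_arrays hr] at hf
  rw [cylWeight_of_not_hasFlaw hr hf.1.injective hf.2, Nat.cast_one]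

end Cancellation

end CylindricTableaux

/-! ### The bijection with standard cylindric tableaux. -/

namespace CylindricTableaux

open Finset

/-! ### Arrays without flaws and standard cylindric tableaux -/

section Tableau

variable {n r : ℕ}

theorem mem_rowsDiagram (hr : 0 < r) {i j : ℕ} :
    (i, j) ∈ rowsDiagram n r ↔ j < r ∧ i * r + j < n := by
  have hn := Nat.div_add_mod n r
  have hlt := Nat.mod_lt n hr
  rw [rowsDiagram, YoungDiagram.mem_ofRowLens]
  simp only [List.length_append, List.length_replicate, List.length_singleton]
  constructor
  · rintro ⟨h1, h2⟩
    rcases lt_or_ge i (n / r) with h | h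
    · rw [List.getElem_append_left (by simpa using h), List.getElem_replicate] at h2
      refine ⟨h2, ?_⟩
      have := Nat.mul_le_mul_right r (Nat.succ_le_of_lt h)
      rw [Nat.succ_mul, mul_comm (n / r)] at this
      omega
    · obtain rfl : i = n / r := by omega
      rw [List.getElem_append_right (by simp)] at h2
      simp only [List.getElem_singleton] at h2
      rw [mul_comm]
      omega
  · rintro ⟨h1, h2⟩
    have h3 : i ≤ n / r := (Nat.le_div_iff_mul_le hr).2 (by omega)
    refine ⟨by omega, ?_⟩
    rcases h3.lt_or_eq with h | rfl
    · rwa [List.getElem_append_left (by simpa using h), List.getElem_replicate]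
    · rw [List.getElem_append_right (by simp)]
      simp only [List.getElem_singleton]
      rw [mul_comm] at h2
      omega

theorem mem_skewCells_rowsDiagram (hr : 0 < r) {b : ℕ × ℕ} :
    b ∈ skewCells (rowsDiagram n r) ⊥ ↔ b.2 < r ∧ b.1 * r + b.2 < n := by
  rw [skewCells, YoungDiagram.cells_bot, sdiff_empty, YoungDiagram.mem_cells]
  exact mem_rowsDiagram hr

theorem lt_rowLen_rowsDiagram (hr : 0 < r) {j : ℕ} :
    j < (rowsDiagram n r).rowLen 0 ↔ j < r ∧ j < n := by
  rw [← YoungDiagram.mem_iff_lt_rowLen, mem_rowsDiagram hr, zero_mul, zero_add]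

theorem mul_add_inj {i j i' j' : ℕ} (hj : j < r) (hj' : j' < r) (h : i * r + j = i' * r + j') :
    i = i' ∧ j = j' := by
  have h1 : j = j' := by
    have := congrArg (· % r) h
    simpa [Nat.mul_add_mod', Nat.mod_eq_of_lt hj, Nat.mod_eq_of_lt hj'] using this
  subst h1
  exact ⟨Nat.eq_of_mul_eq_mul_right (by omega) (Nat.add_right_cancel h), rfl⟩

variable {P : Type*} {T : skewCells (rowsDiagram n r) ⊥ → P} {f : P → ℕ}

theorem toFilling_eq_some_iff (hr : 0 < r) (hT : Function.Surjective T)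
    (hf : ∀ b, f (T b) = b.1.1 * r + b.1.2) (i j : ℕ) (a : P) :
    toFilling T (i, j) = some a ↔ j < r ∧ f a = i * r + j := by
  obtain ⟨⟨⟨i', j'⟩, hb⟩, rfl⟩ := hT a
  have hb' := (mem_skewCells_rowsDiagram hr).1 hb
  rw [hf]
  simp only [toFilling]
  constructor
  · intro h
    split_ifs at h with hij
    have h1 := hf ⟨(i, j), hij⟩
    rw [Option.some_inj.1 h, hf] at h1
    exact ⟨((mem_skewCells_rowsDiagram hr).1 hij).1, h1⟩
  · rintro ⟨hj, h⟩
    obtain ⟨rfl, rfl⟩ := mul_add_inj hb'.1 hj h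
    rw [dif_pos hb]

/-- Box `(i, j)` of the glued diagram carries position `i r + j - r`. The copied column fits this
rule when the diagram has `r` columns; it is kept separate because there are only `n` columns when
`n < r`. -/
theorem glue_eq_some_iff (hr : 0 < r) (hT : Function.Surjective T)
    (hf : ∀ b, f (T b) = b.1.1 * r + b.1.2) (i j : ℕ) (a : P) :
    glue (toFilling T) ((rowsDiagram n r).rowLen 0) 1 (i, j) = some a ↔
      (j < (rowsDiagram n r).rowLen 0 ∧ f a + r = i * r + j) ∨
      (j = (rowsDiagram n r).rowLen 0 ∧ f a = i * r) := by
  rw [glue]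
  dsimp only
  split_ifs with h1 h2 h3
  · obtain ⟨i, rfl⟩ := Nat.exists_eq_add_of_le' h2
    rw [Nat.add_sub_cancel, toFilling_eq_some_iff hr hT hf, add_mul]
    have := (lt_rowLen_rowsDiagram hr).1 h1
    omega
  · obtain rfl : i = 0 := by omega
    have := (lt_rowLen_rowsDiagram hr).1 h1
    simp only [false_iff]
    omega
  · rw [toFilling_eq_some_iff hr hT hf]
    omega
  · simp only [false_iff]
    omega

variable [PartialOrder P]

/-- Vertical conditions say that columns are chains; horizontal ones exclude flaws, the copied
column comparing the end of each row with the start of the next. -/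
theorem isCylindricPTableau_iff (hr : 0 < r) (hT : Function.Surjective T)
    (hf : ∀ b, f (T b) = b.1.1 * r + b.1.2) :
    IsCylindricPTableau (rowsDiagram n r) ⊥ 1 T ↔ IsArray r f ∧ ∀ x, ¬ HasFlaw f x := by
  have hlt : ∀ p, f p < n := by
    intro p
    obtain ⟨b, rfl⟩ := hT p
    rw [hf]
    exact ((mem_skewCells_rowsDiagram hr).1 b.2).2
  have hex : ∀ x < n, ∃ p, f p = x := by
    intro x hx
    have hb : (x / r, x % r) ∈ skewCells (rowsDiagram n r) ⊥ :=
      (mem_skewCells_rowsDiagram hr).2 ⟨Nat.mod_lt _ hr, by rwa [Nat.div_add_mod']⟩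
    exact ⟨T ⟨_, hb⟩, by rw [hf, Nat.div_add_mod']⟩
  have hl := fun j => lt_rowLen_rowsDiagram (n := n) hr (j := j)
  rw [IsCylindricPTableau, IsPTableau]
  simp only [glue_eq_some_iff hr hT hf]
  generalize (rowsDiagram n r).rowLen 0 = l at hl
  constructor
  · rintro ⟨hv, hh⟩
    refine ⟨⟨?_, ?_, ?_⟩, ?_⟩
    · intro p p' h
      obtain ⟨b, rfl⟩ := hT p
      obtain ⟨b', rfl⟩ := hT p'
      rw [hf, hf] at h
      obtain ⟨h1, h2⟩ := mul_add_inj ((mem_skewCells_rowsDiagram hr).1 b.2).1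
        ((mem_skewCells_rowsDiagram hr).1 b'.2).1 h
      rw [Subtype.ext (Prod.ext h1 h2)]
    · intro p p' h
      have h1 := Nat.div_add_mod' (f p) r
      have h2 := Nat.mod_lt (f p) hr
      have h3 := hlt p'
      have h4 := (hl (f p % r)).2 (by omega)
      refine hv (f p / r + 1) (f p % r) p p' (Or.inl ⟨h4, ?_⟩) (Or.inl ⟨h4, ?_⟩)
      · rw [add_mul]; omega
      · rw [add_mul, add_mul]; omega
    · intro p h
      have h1 := hlt p
      obtain ⟨p', hp'⟩ := hex (f p - r) (by omega)
      exact ⟨p', by omega⟩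
    · rintro x ⟨p', hp', h⟩
      have h0 := hlt p'
      obtain ⟨p, hp⟩ := hex x (by omega)
      have h1 := Nat.div_add_mod' x r
      have h2 := Nat.mod_lt x hr
      have h3 := (hl (x % r)).2 (by omega)
      refine hh (x / r + 1) (x % r) p p' (Or.inl ⟨h3, by rw [add_mul]; omega⟩) ?_ (h p hp)
      rcases Nat.lt_or_ge (x % r + 1) r with h4 | h4
      · exact Or.inl ⟨(hl _).2 (by omega), by rw [add_mul]; omega⟩
      -- Here `x` ends a full row, so `l = r` and `x + 1` is read in the copied column.
      · refine Or.inr ⟨?_, by rw [add_mul]; omega⟩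
        have := hl (x % r + 1)
        omega
  · rintro ⟨hA, hF⟩
    refine ⟨fun i j a b ha hb => hA.lt_of_add a b ?_, fun i j a b ha hb hlt' => ?_⟩
    · rw [add_mul] at hb
      omega
    · refine hF (f a) ⟨b, ?_, fun p hp => by rwa [hA.injective hp]⟩
      rcases hb with ⟨h1, h2⟩ | ⟨h1, h2⟩
      · omega
      -- If `l < r`, then `n ≤ l`, and the copied column can only have a box in row `0`, where the
      -- shifted columns have none; so `l = r` and the positions are consecutive.
      · rcases ha with ⟨h3, h4⟩ | ⟨h3, h4⟩
        · have h5 := hl j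
          have h6 := hl l
          have h7 := hlt b
          rcases i with _ | i
          · omega
          · rw [add_mul] at h2 h4
            omega
        · omega

theorem ncard_standardCylindric [Fintype P] (hr : 0 < r) :
    (standardCylindric P (rowsDiagram (Fintype.card P) r) ⊥ 1).ncard =
      {f : P → ℕ | IsArray r f ∧ ∀ x, ¬ HasFlaw f x}.ncard := by
  classical
  set S := skewCells (rowsDiagram (Fintype.card P) r) ⊥ with hS
  have hsurj : ∀ T ∈ standardCylindric P (rowsDiagram (Fintype.card P) r) ⊥ 1,
      Function.Surjective T := fun T hT p => (hT.2 p).exists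
  have hpos : ∀ b b' : S, b.1.1 * r + b.1.2 = b'.1.1 * r + b'.1.2 → b = b' := by
    intro b b' h
    obtain ⟨h1, h2⟩ := mul_add_inj ((mem_skewCells_rowsDiagram hr).1 b.2).1
      ((mem_skewCells_rowsDiagram hr).1 b'.2).1 h
    exact Subtype.ext (Prod.ext h1 h2)
  have hpos' : ∀ x < Fintype.card P, ∃ b : S, b.1.1 * r + b.1.2 = x := by
    intro x hx
    refine ⟨⟨(x / r, x % r), ?_⟩, Nat.div_add_mod' _ _⟩
    rw [hS, mem_skewCells_rowsDiagram hr]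
    exact ⟨Nat.mod_lt _ hr, by rwa [Nat.div_add_mod']⟩
  let F : ∀ T ∈ standardCylindric P (rowsDiagram (Fintype.card P) r) ⊥ 1, P → ℕ :=
    fun T hT p => (hT.2 p).choose.1.1 * r + (hT.2 p).choose.1.2
  have hF : ∀ T hT b, F T hT (T b) = b.1.1 * r + b.1.2 := by
    intro T hT b
    have h := (hT.2 (T b)).choose_spec.2 b rfl
    simp only [F, ← h]
  refine Set.ncard_congr F ?_ ?_ ?_
  · intro T hT
    exact (isCylindricPTableau_iff hr (hsurj T hT) (hF T hT)).1 hT.1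
  · intro T T' hT hT' h
    funext b
    obtain ⟨b', hb'⟩ := hsurj T' hT' (T b)
    have h1 := hF T hT b
    rw [h, ← hb', hF _ hT'] at h1
    rw [← hb', hpos _ _ h1]
  · rintro f ⟨hA, hN⟩
    have hcells : ∀ b : S, ∃ p, f p = b.1.1 * r + b.1.2 := fun b =>
      (exists_eq_iff_of_not_hasFlaw hA.injective hN _).2
        ((mem_skewCells_rowsDiagram hr).1 b.2).2
    choose T hT using hcells
    have hTs : ∀ p, ∃! b, T b = p := by
      intro p
      obtain ⟨b, hb⟩ := hpos' (f p) ((exists_eq_iff_of_not_hasFlaw hA.injective hN _).1 ⟨p, rfl⟩)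
      refine ⟨b, hA.injective ((hT b).trans hb), fun b' hb' => hpos _ _ ?_⟩
      rw [← hT, ← hT, hb', hT, hb]
    have hmem : T ∈ standardCylindric P (rowsDiagram (Fintype.card P) r) ⊥ 1 :=
      ⟨(isCylindricPTableau_iff hr (fun p => (hTs p).exists) hT).2 ⟨hA, hN⟩, hTs⟩
    refine ⟨T, hmem, funext fun p => ?_⟩
    obtain ⟨b, rfl⟩ := (hTs p).exists
    rw [hF _ hmem, hT]

end Tableau

end CylindricTableaux

theorem mainTheorem4 (P : Type*) [Fintype P] [PartialOrder P]
    (hP : CylindricTableaux.IsThreePlusOneFree P) (r : ℕ) (hr : 0 < r) :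
    (∃! c : Nat.Partition (Fintype.card P) → ℤ,
      CylindricTableaux.IsElemExpansion (CylindricTableaux.incGraph P) c) ∧
    ∀ c : Nat.Partition (Fintype.card P) → ℤ,
      CylindricTableaux.IsElemExpansion (CylindricTableaux.incGraph P) c →
      ∑ ν : Nat.Partition (Fintype.card P) with (∀ p ∈ ν.parts, p ≤ r), c ν =
        ((CylindricTableaux.standardCylindric P
          (CylindricTableaux.rowsDiagram (Fintype.card P) r) ⊥ 1).ncard : ℤ) := by
  refine ⟨CylindricTableaux.existsUnique_isElemExpansion _, fun c hc => ?_⟩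
  rw [CylindricTableaux.ncard_standardCylindric hr]
  exact CylindricTableaux.sum_coeff_eq_ncard hP hr hc
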